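/- Let $n\ge 1$, $1<p_0<\infty$, $0<\delta<1$. A weight is a non-negative locally integrable function $w$ on $\mathbb{R}^n$, and $w\in A_{p_0}$ with constant $K<\infty$ means that for every cube $Q\subset\mathbb{R}^n$ $$\frac1{|Q|}\int_Q w\,dx\left(\frac1{|Q|}\int_Q w^{1-p_0'}\,dx\right)^{p_0-1}\le K,\qquad \frac1{p_0}+\frac1{p_0'}=1 .$$ Let $\mathcal F$ be a family of pairs $(f,g)$ of non-negative measurable functions on $\mathbb{R}^n$. Suppose that for every $K<\infty$ there is a constant $C_0<\infty$ such that for every $w\in A_{p_0}$ with constant $K$ $$\int_{\mathbb{R}^n} f(x)^{p_0}w(x)^{\delta}\,dx\le C_0\int_{\mathbb{R}^n} g(x)^{p_0}w(x)^{\delta}\,dx$$ for all $(f,g)\in\mathcal F$ for which the left-hand side is finite. Let $p(\cdot):\mathbb{R}^n\to(1,\infty)$ be globally log-Hölder continuous, i.e. there are $c_1,c_2,p_\infty>0$ with $$|p(x)-p(y)|\le \frac{c_1}{\log(e+1/|x-y|)}\ \ (x\ne y),\qquad |p(x)-p_\infty|\le\frac{c_2}{\log(e+|x|)}\qquad (x,y\in\mathbb{R}^n).$$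 Put $p^-=\operatorname{ess\,inf}p$, $p^+=\operatorname{ess\,sup}p$, and assume $$\frac{p_0}{1+\delta(p_0-1)}<p^-\le p^+<\frac{p_0}{1-\delta}.$$ Then there is a constant $C<\infty$ such that $$\|f\|_{p(\cdot)}\le C\,\|g\|_{p(\cdot)}\qquad\text{for all }(f,g)\in\mathcal F\text{ with } f\in L^{p(\cdot)}(\mathbb{R}^n).$$ Here $\|f\|_{p(\cdot)}=\inf\{\lambda>0:\int_{\mathbb{R}^n}(|f(x)|/\lambda)^{p(x)}dx\le1\}$ (with $\inf\emptyset=\infty$), and $f\in L^{p(\cdot)}(\mathbb{R}^n)$ means that $f$ is measurable and $\int_{\mathbb{R}^n}(|f(x)|/\lambda)^{p(x)}dx<\infty$ for some $\lambda>0$. -/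

import Mathlib

open MeasureTheory Set
open scoped ENNReal NNReal

noncomputable section

namespace VarLebesgue

/-- `ℝⁿ` with its Euclidean norm and Lebesgue measure. -/
abbrev Rn (n : ℕ) : Type := EuclideanSpace ℝ (Fin n)

/-- The closed axis-parallel cube with lower corner `a` and side length `l`. -/
def cube {n : ℕ} (a : Rn n) (l : ℝ) : Set (Rn n) :=
  {x | ∀ i, x i ∈ Icc (a i) (a i + l)}

/-- The average `1/|Q| ∫_Q h` over the cube `Q`. -/
def cubeAverage {n : ℕ} (a : Rn n) (l : ℝ) (h : Rn n → ℝ≥0∞) : ℝ≥0∞ :=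
  (volume (cube a l))⁻¹ * ∫⁻ x in cube a l, h x

/-- A weight is a non-negative locally integrable function. -/
def IsWeight {n : ℕ} (w : Rn n → ℝ≥0) : Prop :=
  LocallyIntegrable (fun x => (w x : ℝ)) volume

/-- `w` is an `A_q` weight, `1 < q < ∞`, with constant (at most) `K`:
`(1/|Q| ∫_Q w) (1/|Q| ∫_Q w^{1-q'})^{q-1} ≤ K` for every cube `Q`. The powers are taken in `[0,∞]`,
so that `w^{1-q'}` is infinite where `w` vanishes. A weight belongs to `A_q` when this holds for
some finite `K`. -/
def IsApWeight {n : ℕ} (q : ℝ) (K : ℝ≥0) (w : Rn n → ℝ≥0) : Prop :=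
  IsWeight w ∧ ∀ (a : Rn n) (l : ℝ), 0 < l →
    cubeAverage a l (fun x => w x) *
      cubeAverage a l (fun x => (w x : ℝ≥0∞) ^ (1 - q.conjExponent)) ^ (q - 1) ≤ (K : ℝ≥0∞)

/-- The weighted integral `∫ f(x)^s w(x)^δ dx`. -/
def weightedIntegral {n : ℕ} (s δ : ℝ) (w : Rn n → ℝ≥0) (f : Rn n → ℝ≥0∞) : ℝ≥0∞ :=
  ∫⁻ x, f x ^ s * (w x : ℝ≥0∞) ^ δ

/-- The modular `∫ f(x)^{p(x)} dx`. -/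
def modular {n : ℕ} (p : Rn n → ℝ) (f : Rn n → ℝ≥0∞) : ℝ≥0∞ :=
  ∫⁻ x, f x ^ p x

/-- A non-negative function belongs to `L^{p(·)}`. -/
def MemVarLp {n : ℕ} (p : Rn n → ℝ) (f : Rn n → ℝ≥0∞) : Prop :=
  AEMeasurable f volume ∧ ∃ r : ℝ≥0, 0 < r ∧ modular p (fun x => f x / r) < ∞

/-- The Luxemburg norm `inf {r > 0 : ∫ (f(x)/r)^{p(x)} dx ≤ 1}`, with `inf ∅ = ∞`. -/
def varNorm {n : ℕ} (p : Rn n → ℝ) (f : Rn n → ℝ≥0∞) : ℝ≥0∞ :=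
  sInf {t : ℝ≥0∞ | ∃ r : ℝ≥0, 0 < r ∧ modular p (fun x => f x / r) ≤ 1 ∧ t = r}

/-- Local log-Hölder continuity. For `x = y` the inequality is `0 ≤ c`. -/
def LocallyLogHolder {n : ℕ} (p : Rn n → ℝ) : Prop :=
  ∃ c : ℝ, 0 < c ∧ ∀ x y, |p x - p y| ≤ c * (1 / Real.log (Real.exp 1 + 1 / ‖x - y‖))

/-- The log-Hölder decay condition at infinity. -/
def LogHolderDecay {n : ℕ} (p : Rn n → ℝ) : Prop :=
  ∃ pinf c : ℝ, 0 < pinf ∧ 0 < c ∧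
    ∀ x, |p x - pinf| ≤ c * (1 / Real.log (Real.exp 1 + ‖x‖))

/-- The class `P_log`: globally log-Hölder continuous exponents `p : ℝⁿ → (1, ∞)` with `p⁻ > 1`. -/
structure IsLogExponent {n : ℕ} (p : Rn n → ℝ) : Prop where
  one_lt : ∀ x, 1 < p x
  locally_logHolder : LocallyLogHolder p
  decay : LogHolderDecay p
  one_lt_essInf : 1 < essInf p volume

end VarLebesgue

end

namespace VarLebesgue

variable {n : ℕ}

/-! A single weight adapted to the pair turns the weighted inequality into a comparison of norms.
Let φ = f/(2a) and γ = g/r have modulars at most 1, with a just below the norm of f. Suppose T is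
integrable with φ^p, γ^p ≤ T, and put w^δ = T^(1 - p₀/p). Then φ^p₀ w^δ ≤ T, and likewise for γ, so
both weighted integrals are at most ∫ T; the first is therefore finite, and the hypothesis gives
(2a)^p₀ ∫ φ^p₀ w^δ ≤ C₀ r^p₀ ∫ T. Conversely φ^p ≤ λT + λ^(1-p₀) φ^p₀ w^δ for every λ > 0
(`rpow_le_mul_add_rpow_mul`). The modular of φ is bounded below, so for small λ the first term is
absorbed and ∫ φ^p₀ w^δ is bounded below. Hence a ≲ r.

It remains to find T with w in A_{p₀}, with constants independent of the pair
(`exists_majorant_isApWeight`). Since w = T^s (T^(1-s))^(1-p₀) for the exponent s = `splitExponent`,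
it suffices that T^s and T^(1-s) satisfy the A₁ condition. The bounds on p⁻ and p⁺ say exactly that
s stays in a compact part of (0,1). Let U = φ^p + γ^p + (1+|x|)^(-n-1) and T = (U^θ + M(U^θ))^(1/θ),
with θ < 1 above all values of s and 1 - s. The strong type inequality for M bounds ∫ T, and
Coifman–Rochberg makes constant powers of T below θ into A₁ weights.

Log-Hölder continuity passes from constant to variable powers
(`exists_cubeAverage_rpow_variable_le`). On a cube where T is large, integrability bounds log T at a
suitable point by the logarithm of the inverse side length, which the local condition compensates.
Where T is small, the last summand of U bounds it below by a power of 1+|x|, and the decay condition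
allows the limiting exponent instead. -/

/-! ### Cubes, averages and the uncentred maximal function. -/

/-- The open axis-parallel cube with lower corner `a` and side length `l`. -/
def openCube (a : Rn n) (l : ℝ) : Set (Rn n) :=
  {x | ∀ i, x i ∈ Ioo (a i) (a i + l)}

/-- The uncentred Hardy-Littlewood maximal function over cubes. -/
noncomputable def maximal (h : Rn n → ℝ≥0∞) (x : Rn n) : ℝ≥0∞ :=
  ⨆ Q : {Q : Rn n × ℝ // 0 < Q.2 ∧ x ∈ openCube Q.1 Q.2}, cubeAverage Q.1.1 Q.1.2 h

theorem isOpen_openCube (a : Rn n) (l : ℝ) : IsOpen (openCube a l) := by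
  have : openCube a l = ⋂ i, (fun x : Rn n => x i) ⁻¹' Ioo (a i) (a i + l) := by
    ext x; simp [openCube]
  rw [this]
  exact isOpen_iInter_of_finite fun i => isOpen_Ioo.preimage (by fun_prop)

theorem isClosed_cube (a : Rn n) (l : ℝ) : IsClosed (cube a l) := by
  have : cube a l = ⋂ i, (fun x : Rn n => x i) ⁻¹' Icc (a i) (a i + l) := by
    ext x; simp [cube]
  rw [this]
  exact isClosed_iInter fun i => isClosed_Icc.preimage (by fun_prop)

theorem measurableSet_cube (a : Rn n) (l : ℝ) : MeasurableSet (cube a l) :=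
  (isClosed_cube a l).measurableSet

theorem volume_cube (a : Rn n) (l : ℝ) : volume (cube a l) = ENNReal.ofReal l ^ n := by
  have h : cube a l = (WithLp.ofLp : Rn n → (Fin n → ℝ)) ⁻¹'
      (Set.pi univ fun i => Icc (a i) (a i + l)) := by
    ext x; simp only [cube, mem_ofPred_eq, mem_preimage, mem_univ_pi]
  rw [h, (PiLp.volume_preserving_ofLp (Fin n)).measure_preimage
    (MeasurableSet.univ_pi fun i => measurableSet_Icc).nullMeasurableSet, volume_pi_pi]
  simp

theorem volume_cube_ne_zero (a : Rn n) {l : ℝ} (hl : 0 < l) : volume (cube a l) ≠ 0 := by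
  rw [volume_cube]; exact pow_ne_zero _ (by simpa using hl)

theorem volume_cube_ne_top (a : Rn n) (l : ℝ) : volume (cube a l) ≠ ∞ := by
  rw [volume_cube]; exact ENNReal.pow_ne_top ENNReal.ofReal_ne_top

theorem openCube_subset_cube (a : Rn n) (l : ℝ) : openCube a l ⊆ cube a l :=
  fun _ hx i => ⟨(hx i).1.le, (hx i).2.le⟩

theorem openCube_nonempty (a : Rn n) {l : ℝ} (hl : 0 < l) : (openCube a l).Nonempty :=
  ⟨WithLp.toLp 2 fun i => a i + l / 2, fun i => by
    constructor <;> simp <;> linarith⟩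

/-- The point whose coordinates are those of `a`, decreased by `r`. -/
noncomputable def shiftCorner (a : Rn n) (r : ℝ) : Rn n := WithLp.toLp 2 fun i => a i - r

@[simp] theorem shiftCorner_apply (a : Rn n) (r : ℝ) (i : Fin n) : shiftCorner a r i = a i - r :=
  rfl

theorem cubeAverage_mul_volume (a : Rn n) {l : ℝ} (hl : 0 < l) (h : Rn n → ℝ≥0∞) :
    cubeAverage a l h * ENNReal.ofReal l ^ n = ∫⁻ x in cube a l, h x := by
  rw [← volume_cube a l, cubeAverage, mul_comm, ← mul_assoc,
    ENNReal.mul_inv_cancel (volume_cube_ne_zero a hl) (volume_cube_ne_top a l), one_mul]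

/-- Averages over a cube are controlled by those over a cube `c` times as long. -/
theorem cubeAverage_le_of_subset (a b : Rn n) {l : ℝ} (hl : 0 < l) (m : ℕ) (hm : 0 < m)
    (hsub : cube a l ⊆ cube b (m * l)) (h : Rn n → ℝ≥0∞) :
    cubeAverage a l h ≤ (m : ℝ≥0∞) ^ n * cubeAverage b (m * l) h := by
  have hl0 : ENNReal.ofReal l ^ n ≠ 0 := pow_ne_zero _ (by simpa using hl)
  have hlt : ENNReal.ofReal l ^ n ≠ ∞ := ENNReal.pow_ne_top ENNReal.ofReal_ne_top
  have hml : 0 < (m : ℝ) * l := by positivity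
  rw [← ENNReal.mul_le_mul_iff_left hl0 hlt, cubeAverage_mul_volume a hl,
    mul_right_comm, ← mul_pow, mul_comm, ← ENNReal.ofReal_natCast m,
    ← ENNReal.ofReal_mul (by positivity), cubeAverage_mul_volume b hml]
  exact lintegral_mono_set hsub

theorem cubeAverage_le_maximal {a x : Rn n} {l : ℝ} (hl : 0 < l) (hx : x ∈ openCube a l)
    (h : Rn n → ℝ≥0∞) : cubeAverage a l h ≤ maximal h x :=
  le_iSup (fun Q : {Q : Rn n × ℝ // 0 < Q.2 ∧ x ∈ openCube Q.1 Q.2} =>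
    cubeAverage Q.1.1 Q.1.2 h) ⟨(a, l), hl, hx⟩

theorem cube_subset_triple (a : Rn n) {l : ℝ} (hl : 0 < l) :
    cube a l ⊆ openCube (shiftCorner a l) ((3 : ℕ) * l) := fun x hx i => by
  have := hx i
  simp only [mem_Icc, mem_Ioo, shiftCorner_apply] at *
  constructor <;> push_cast <;> linarith

theorem cubeAverage_le_maximal_of_mem {a x : Rn n} {l : ℝ} (hl : 0 < l) (hx : x ∈ cube a l)
    (h : Rn n → ℝ≥0∞) : cubeAverage a l h ≤ 3 ^ n * maximal h x := by
  refine (cubeAverage_le_of_subset a (shiftCorner a l) hl 3 (by norm_num)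
    ((cube_subset_triple a hl).trans (openCube_subset_cube _ _)) h).trans ?_
  gcongr
  · simp
  · exact cubeAverage_le_maximal (by positivity) (cube_subset_triple a hl hx) h

/-- Taking the supremum over open cubes makes the level sets open, so the maximal function is
measurable even if `h` is not. -/
theorem setOf_lt_maximal (h : Rn n → ℝ≥0∞) (t : ℝ≥0∞) :
    {x | t < maximal h x} =
      ⋃ Q ∈ {Q : Rn n × ℝ | 0 < Q.2 ∧ t < cubeAverage Q.1 Q.2 h}, openCube Q.1 Q.2 := by
  ext x
  simp only [mem_ofPred_eq, maximal, lt_iSup_iff, mem_iUnion, Subtype.exists]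
  constructor
  · rintro ⟨Q, ⟨h1, h2⟩, h3⟩; exact ⟨Q, ⟨h1, h3⟩, h2⟩
  · rintro ⟨Q, ⟨h1, h3⟩, h2⟩; exact ⟨Q, ⟨h1, h2⟩, h3⟩

theorem measurable_maximal (h : Rn n → ℝ≥0∞) : Measurable (maximal h) :=
  measurable_of_Ioi fun t => by
    change MeasurableSet {x | t < maximal h x}
    rw [setOf_lt_maximal]
    exact (isOpen_biUnion fun Q _ => isOpen_openCube _ _).measurableSet

/-! ### Weak and strong type inequalities for the maximal function. -/

/-- The weak type `(1,1)` inequality for the maximal function. -/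
theorem mul_volume_lt_maximal_le (hn : 1 ≤ n) (h : Rn n → ℝ≥0∞) (t : ℝ≥0∞) :
    t * volume {x | t < maximal h x} ≤ 5 ^ n * ∫⁻ x, h x := by
  rcases eq_or_ne t 0 with rfl | ht0
  · simp
  rcases eq_or_ne t ∞ with rfl | htt
  · simp
  rcases eq_or_ne (∫⁻ x, h x) ∞ with hi | hi
  · rw [hi, ENNReal.mul_top (by positivity)]; exact le_top
  set S : Set (Rn n × ℝ) := {Q | 0 < Q.2 ∧ t < cubeAverage Q.1 Q.2 h} with hS
  have key : ∀ Q ∈ S, t * ENNReal.ofReal Q.2 ^ n ≤ ∫⁻ x in cube Q.1 Q.2, h x := fun Q hQ => by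
    rw [← cubeAverage_mul_volume Q.1 hQ.1 h]
    gcongr
    exact hQ.2.le
  -- The Vitali covering lemma needs bounded sides; they are bounded because t lⁿ ≤ ∫ h and n ≥ 1.
  have hR : ∀ Q ∈ S, Q.2 ≤ 1 + ((∫⁻ x, h x) / t).toReal := fun Q hQ => by
    have h1 : ENNReal.ofReal Q.2 ^ n ≤ (∫⁻ x, h x) / t := by
      rw [ENNReal.le_div_iff_mul_le (.inl ht0) (.inl htt), mul_comm]
      exact (key Q hQ).trans (setLIntegral_le_lintegral _ _)
    have h2 := ENNReal.toReal_mono (ENNReal.div_ne_top hi ht0) h1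
    rw [ENNReal.toReal_pow, ENNReal.toReal_ofReal hQ.1.le] at h2
    rcases le_total Q.2 1 with h3 | h3
    · have := ENNReal.toReal_nonneg (a := (∫⁻ x, h x) / t); linarith
    · have := le_self_pow₀ h3 (by omega : n ≠ 0); linarith
  obtain ⟨u, huS, hdisj, hu⟩ := Vitali.exists_disjoint_subfamily_covering_enlargement
    (fun Q : Rn n × ℝ => cube Q.1 Q.2) S (fun Q => Q.2) 2 (by norm_num) (fun Q hQ => hQ.1.le)
    _ hR (fun Q hQ => (openCube_nonempty Q.1 hQ.1).mono (openCube_subset_cube _ _))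
  have hcount : u.Countable := hdisj.countable_of_nonempty_interior fun Q hQ =>
    (openCube_nonempty Q.1 (huS hQ).1).mono
      (interior_maximal (openCube_subset_cube _ _) (isOpen_openCube _ _))
  -- A cube meeting a selected `P` and at most twice as long lies in `P` enlarged by two sides in
  -- each direction, whence 5 = 1 + 2 + 2.
  have hcov : {x | t < maximal h x} ⊆
      ⋃ Q ∈ u, cube (shiftCorner Q.1 (2 * Q.2)) (5 * Q.2) := by
    rw [setOf_lt_maximal]
    refine iUnion₂_subset fun Q hQ x hx => ?_
    obtain ⟨P, hPu, ⟨y, hyQ, hyP⟩, hle⟩ := hu Q hQ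
    refine mem_iUnion₂.2 ⟨P, hPu, fun i => ?_⟩
    have h1 := hx i
    have h2 := hyQ i
    have h3 := hyP i
    simp only [mem_Icc, mem_Ioo, shiftCorner_apply] at *
    constructor <;> linarith
  calc t * volume {x | t < maximal h x}
      ≤ t * ∑' Q : u, volume (cube (shiftCorner Q.1.1 (2 * Q.1.2)) (5 * Q.1.2)) := by
        gcongr
        exact (measure_mono hcov).trans (measure_biUnion_le _ hcount _)
    _ = 5 ^ n * ∑' Q : u, t * ENNReal.ofReal Q.1.2 ^ n := by
        rw [← ENNReal.tsum_mul_left, ← ENNReal.tsum_mul_left]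
        congr 1; ext Q
        rw [volume_cube, ENNReal.ofReal_mul (by norm_num), mul_pow]
        norm_num
        ring
    _ ≤ 5 ^ n * ∑' Q : u, ∫⁻ x in cube Q.1.1 Q.1.2, h x := by
        gcongr with Q
        exact key Q.1 (huS Q.2)
    _ = 5 ^ n * ∫⁻ x in ⋃ Q ∈ u, cube Q.1 Q.2, h x := by
        rw [lintegral_biUnion hcount (fun Q _ => measurableSet_cube _ _) hdisj]
    _ ≤ _ := by
        gcongr
        exact Measure.restrict_le_self

theorem setLIntegral_Ioi_ite_ofReal_lt_ofReal {a b : ℝ} (ha : 0 < a) (hb : 0 ≤ b) :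
    ∫⁻ t in Ioi (0 : ℝ), (if ENNReal.ofReal t < ENNReal.ofReal b
      then ENNReal.ofReal (a * t ^ (a - 1)) else 0) = ENNReal.ofReal b ^ a := by
  have h1 : ∀ t ∈ Ioi (0 : ℝ), (if ENNReal.ofReal t < ENNReal.ofReal b
      then ENNReal.ofReal (a * t ^ (a - 1)) else 0) =
      (Iio b).indicator (fun t => ENNReal.ofReal (a * t ^ (a - 1))) t := fun t ht => by
    rw [indicator_apply]
    simp only [ENNReal.ofReal_lt_ofReal_iff_of_nonneg (le_of_lt ht), mem_Iio]
  rw [setLIntegral_congr_fun measurableSet_Ioi h1, setLIntegral_indicator measurableSet_Iio,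
    Iio_inter_Ioi, restrict_Ioo_eq_restrict_Ioc, ← ofReal_integral_eq_lintegral_ofReal,
    ← intervalIntegral.integral_of_le hb, intervalIntegral.integral_const_mul,
    integral_rpow (.inl (by linarith)), ENNReal.ofReal_rpow_of_nonneg hb ha.le]
  · congr 1
    rw [sub_add_cancel, Real.zero_rpow ha.ne']
    field_simp
    ring
  · have := (intervalIntegral.intervalIntegrable_rpow' (a := 0) (b := b)
      (by linarith : -1 < a - 1)).const_mul a
    exact (intervalIntegrable_iff_integrableOn_Ioc_of_le hb).1 this
  · filter_upwards [ae_restrict_mem measurableSet_Ioc] with t ht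
    exact mul_nonneg ha.le (Real.rpow_nonneg ht.1.le _)

/-- Every power of an extended non-negative number is an integral over the levels below it. -/
theorem setLIntegral_Ioi_ite_ofReal_lt {a : ℝ} (ha : 0 < a) (y : ℝ≥0∞) :
    ∫⁻ t in Ioi (0 : ℝ), (if ENNReal.ofReal t < y
      then ENNReal.ofReal (a * t ^ (a - 1)) else 0) = y ^ a := by
  rcases eq_or_ne y ∞ with rfl | hy
  · rw [ENNReal.top_rpow_of_pos ha]
    refine ENNReal.eq_top_of_forall_nnreal_le fun r => ?_
    have h := setLIntegral_Ioi_ite_ofReal_lt_ofReal ha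
      (Real.rpow_nonneg (NNReal.coe_nonneg r) a⁻¹)
    rw [ENNReal.ofReal_rpow_of_nonneg (by positivity) ha.le, ← Real.rpow_mul (NNReal.coe_nonneg r),
      inv_mul_cancel₀ ha.ne', Real.rpow_one, ENNReal.ofReal_coe_nnreal] at h
    rw [← h]
    refine lintegral_mono fun t => ?_
    simp only [ENNReal.ofReal_lt_top, if_true]
    split_ifs <;> simp
  · lift y to ℝ≥0 using hy
    simpa using setLIntegral_Ioi_ite_ofReal_lt_ofReal ha y.2

theorem measurable_ite_ofReal_lt {α : Type*} [MeasurableSpace α] {f : α → ℝ≥0∞}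
    (hf : Measurable f) {c : ℝ → ℝ≥0∞} (hc : Measurable c) :
    Measurable fun z : α × ℝ => if ENNReal.ofReal z.2 < f z.1 then c z.2 else 0 :=
  Measurable.ite (measurableSet_lt (by fun_prop) (by fun_prop)) (by fun_prop) measurable_const

/-- The layer cake formula for powers of `[0,∞]`-valued functions. -/
theorem lintegral_rpow_eq_lintegral_level {α : Type*} [MeasurableSpace α] {μ : Measure α}
    [SFinite μ] {f : α → ℝ≥0∞} (hf : Measurable f) {a : ℝ} (ha : 0 < a) :
    ∫⁻ x, f x ^ a ∂μ =
      ∫⁻ t in Ioi (0 : ℝ), ENNReal.ofReal (a * t ^ (a - 1)) * μ {x | ENNReal.ofReal t < f x} := by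
  simp_rw [← setLIntegral_Ioi_ite_ofReal_lt ha]
  rw [lintegral_lintegral_swap
    (measurable_ite_ofReal_lt hf (c := fun t => ENNReal.ofReal (a * t ^ (a - 1)))
      (by fun_prop)).aemeasurable]
  refine lintegral_congr fun t => ?_
  have hm : MeasurableSet {x | ENNReal.ofReal t < f x} := measurableSet_lt measurable_const hf
  rw [← lintegral_indicator_const hm]
  refine lintegral_congr fun x => ?_
  simp [indicator_apply]

theorem cubeAverage_mono (a : Rn n) (l : ℝ) {f g : Rn n → ℝ≥0∞} (h : ∀ x, f x ≤ g x) :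
    cubeAverage a l f ≤ cubeAverage a l g := by
  unfold cubeAverage; gcongr; exact h _

theorem cubeAverage_const (a : Rn n) {l : ℝ} (hl : 0 < l) (c : ℝ≥0∞) :
    cubeAverage a l (fun _ => c) = c := by
  rw [cubeAverage, lintegral_const, Measure.restrict_apply_univ, mul_comm, mul_assoc,
    ENNReal.mul_inv_cancel (volume_cube_ne_zero a hl) (volume_cube_ne_top a l), mul_one]

theorem cubeAverage_add (a : Rn n) (l : ℝ) {f : Rn n → ℝ≥0∞} (hf : AEMeasurable f)
    (g : Rn n → ℝ≥0∞) :
    cubeAverage a l (fun x => f x + g x) = cubeAverage a l f + cubeAverage a l g := by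
  rw [cubeAverage, lintegral_add_left' hf.restrict, mul_add]; rfl

theorem maximal_le_iff {h : Rn n → ℝ≥0∞} {x : Rn n} {c : ℝ≥0∞} :
    maximal h x ≤ c ↔ ∀ a l, 0 < l → x ∈ openCube a l → cubeAverage a l h ≤ c := by
  simp [maximal, iSup_le_iff]

theorem maximal_add_le {f : Rn n → ℝ≥0∞} (hf : AEMeasurable f) (g : Rn n → ℝ≥0∞) (x : Rn n) :
    maximal (fun x => f x + g x) x ≤ maximal f x + maximal g x :=
  maximal_le_iff.2 fun a l hl hx => by
    rw [cubeAverage_add a l hf]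
    exact add_le_add (cubeAverage_le_maximal hl hx f) (cubeAverage_le_maximal hl hx g)

theorem maximal_mono {f g : Rn n → ℝ≥0∞} (h : ∀ x, f x ≤ g x) (x : Rn n) :
    maximal f x ≤ maximal g x :=
  maximal_le_iff.2 fun a l hl hx =>
    (cubeAverage_mono a l h).trans (cubeAverage_le_maximal hl hx g)

theorem maximal_const_le (c : ℝ≥0∞) (x : Rn n) : maximal (fun _ => c) x ≤ c :=
  maximal_le_iff.2 fun a _ hl _ => (cubeAverage_const a hl c).le

/-- The part of `h` below `t` contributes at most `t` to the maximal function, so only the part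
above `t` enters the weak type inequality. This is the truncation of Marcinkiewicz interpolation. -/
theorem mul_volume_two_mul_lt_maximal_le (hn : 1 ≤ n) (h : Rn n → ℝ≥0∞) {t : ℝ≥0∞}
    (ht : t ≠ ∞) :
    t * volume {x | 2 * t < maximal h x} ≤ 5 ^ n * ∫⁻ x, {x | t < h x}.indicator h x := by
  refine le_trans ?_ (mul_volume_lt_maximal_le hn ({x | t < h x}.indicator h) t)
  refine mul_le_mul_right (measure_mono fun x (hx : 2 * t < maximal h x) => ?_) _
  have h1 : maximal h x ≤ t + maximal ({x | t < h x}.indicator h) x := by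
    refine (maximal_mono (g := fun x => t + {x | t < h x}.indicator h x) (fun y => ?_) x).trans
      ((maximal_add_le aemeasurable_const _ x).trans (add_le_add (maximal_const_le t x) le_rfl))
    by_cases hy : t < h y
    · rw [indicator_of_mem (by exact hy)]; exact le_add_self
    · exact (not_lt.1 hy).trans le_self_add
  have h2 := hx.trans_le h1
  rw [two_mul] at h2
  exact (ENNReal.add_lt_add_iff_left ht).1 h2

/-- The strong type `(q,q)` inequality for the maximal function. -/
theorem exists_lintegral_maximal_rpow_le (hn : 1 ≤ n) {q : ℝ} (hq : 1 < q) :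
    ∃ C : ℝ≥0, ∀ h : Rn n → ℝ≥0∞, Measurable h →
      ∫⁻ x, maximal h x ^ q ≤ C * ∫⁻ x, h x ^ q := by
  refine ⟨5 ^ n * ((2 * q / (q - 1)).toNNReal * 2 ^ (q - 1)), fun h hh => ?_⟩
  have hq1 : 0 < q - 1 := by linarith
  have level : ∀ t ∈ Ioi (0 : ℝ),
      ENNReal.ofReal (q * t ^ (q - 1)) * volume {x | ENNReal.ofReal t < maximal h x} ≤
      5 ^ n * ENNReal.ofReal (2 * q / (q - 1)) * ∫⁻ x, h x * (if ENNReal.ofReal t < 2 * h x then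
        ENNReal.ofReal ((q - 1) * t ^ (q - 1 - 1)) else 0) := fun t ht => by
    have ht' : (0 : ℝ) < t := ht
    have h1 := mul_volume_two_mul_lt_maximal_le hn h (t := ENNReal.ofReal (t / 2))
      ENNReal.ofReal_ne_top
    have h2 : 2 * ENNReal.ofReal (t / 2) = ENNReal.ofReal t := by
      rw [← ENNReal.ofReal_ofNat 2, ← ENNReal.ofReal_mul (by norm_num)]; congr 1; ring
    rw [h2] at h1
    -- The factor t/2 is split off for the weak type inequality at level t/2; the rest is the layer
    -- cake density of the power q - 1.
    have h3 : ENNReal.ofReal (q * t ^ (q - 1)) =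
        ENNReal.ofReal (2 * q / (q - 1)) * ENNReal.ofReal ((q - 1) * t ^ (q - 1 - 1)) *
          ENNReal.ofReal (t / 2) := by
      rw [← ENNReal.ofReal_mul (by positivity), ← ENNReal.ofReal_mul (by positivity),
        Real.rpow_sub_one ht'.ne' (q - 1)]
      congr 1
      field_simp
    rw [h3, mul_assoc]
    calc _ ≤ ENNReal.ofReal (2 * q / (q - 1)) * ENNReal.ofReal ((q - 1) * t ^ (q - 1 - 1)) *
          (5 ^ n * ∫⁻ x, {x | ENNReal.ofReal (t / 2) < h x}.indicator h x) := by gcongr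
      _ = 5 ^ n * ENNReal.ofReal (2 * q / (q - 1)) *
          (ENNReal.ofReal ((q - 1) * t ^ (q - 1 - 1)) *
            ∫⁻ x, {x | ENNReal.ofReal (t / 2) < h x}.indicator h x) := by ring
      _ = _ := by
        rw [← lintegral_const_mul' _ _ ENNReal.ofReal_ne_top]
        congr 2; ext x
        have h4 : (ENNReal.ofReal (t / 2) < h x) ↔ (ENNReal.ofReal t < 2 * h x) := by
          rw [← h2, ENNReal.mul_lt_mul_iff_right (by norm_num) (by norm_num)]
        simp only [indicator_apply, mem_ofPred_eq, h4]
        split_ifs <;> simp [mul_comm]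
  rw [lintegral_rpow_eq_lintegral_level (measurable_maximal h) (by linarith)]
  refine (setLIntegral_mono' measurableSet_Ioi level).trans ?_
  rw [lintegral_const_mul' _ _ (ENNReal.mul_ne_top (by simp) ENNReal.ofReal_ne_top),
    lintegral_lintegral_swap]
  · have : ∀ x, ∫⁻ t in Ioi (0 : ℝ), h x * (if ENNReal.ofReal t < 2 * h x then
        ENNReal.ofReal ((q - 1) * t ^ (q - 1 - 1)) else 0) = 2 ^ (q - 1) * h x ^ q := fun x => by
      rw [lintegral_const_mul, setLIntegral_Ioi_ite_ofReal_lt hq1,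
        ENNReal.mul_rpow_of_nonneg _ _ hq1.le, mul_left_comm]
      · congr 1
        conv_lhs => rw [← ENNReal.rpow_one (h x), ← ENNReal.rpow_mul, one_mul]
        rw [← ENNReal.rpow_add_of_nonneg _ _ zero_le_one hq1.le, add_sub_cancel]
      · exact Measurable.ite (measurableSet_lt (by fun_prop) measurable_const) (by fun_prop)
          measurable_const
    simp_rw [this]
    rw [lintegral_const_mul' _ _ (by simp)]
    push_cast
    rw [ENNReal.coe_rpow_of_nonneg _ hq1.le]
    simp only [mul_assoc, ENNReal.ofReal, ENNReal.coe_ofNat, le_refl]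
  · refine Measurable.aemeasurable ?_
    have h5 := (measurable_ite_ofReal_lt (hh.const_mul 2)
      (c := fun t => ENNReal.ofReal ((q - 1) * t ^ (q - 1 - 1))) (by fun_prop)).comp
        measurable_swap
    exact (hh.comp measurable_snd).mul h5

/-! ### Kolmogorov's inequality and the Coifman–Rochberg theorem. -/

/-- Kolmogorov's inequality for the maximal function. -/
theorem exists_cubeAverage_maximal_rpow_le (hn : 1 ≤ n) {s : ℝ} (hs : 0 < s) (hs1 : s < 1) :
    ∃ C : ℝ≥0, ∀ (h : Rn n → ℝ≥0∞) (a : Rn n) (l : ℝ), 0 < l →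
      cubeAverage a l (fun x => maximal h x ^ s) ≤
        C * ((volume (cube a l))⁻¹ * ∫⁻ x, h x) ^ s := by
  refine ⟨1 + 5 ^ n * (s / (1 - s)).toNNReal, fun h a l hl => ?_⟩
  have hs1' : 0 < 1 - s := by linarith
  have hv0 := volume_cube_ne_zero a hl
  have hvt := volume_cube_ne_top a l
  set A := (volume (cube a l))⁻¹ * ∫⁻ x, h x with hA
  have hAv : volume (cube a l) * A = ∫⁻ x, h x := by
    rw [hA, ← mul_assoc, ENNReal.mul_inv_cancel hv0 hvt, one_mul]
  rcases eq_or_ne A ∞ with hAt | hAt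
  · rw [hAt, ENNReal.top_rpow_of_pos hs, ENNReal.mul_top (by positivity)]; exact le_top
  rcases eq_or_ne A 0 with hA0 | hA0
  · have h0 : ∫⁻ x, h x = 0 := by rw [← hAv, hA0, mul_zero]
    have : ∀ x, maximal h x = 0 := fun x => by
      refine le_antisymm (maximal_le_iff.2 fun b m hm _ => ?_) zero_le
      have : ∫⁻ x in cube b m, h x = 0 :=
        le_antisymm (h0 ▸ setLIntegral_le_lintegral _ _) zero_le
      simp [cubeAverage, this]
    simp [this, ENNReal.zero_rpow_of_pos hs, cubeAverage]
  set r := A.toReal with hr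
  have hr0 : 0 < r := ENNReal.toReal_pos hA0 hAt
  have hAr : A = ENNReal.ofReal r := (ENNReal.ofReal_toReal hAt).symm
  -- Below level `A` the measure is at most that of the cube; above it the weak type bound is used,
  -- and s < 1 makes t^(s-2) integrable at infinity.
  have level : ∀ t ∈ Ioi (0 : ℝ), ENNReal.ofReal (s * t ^ (s - 1)) *
      (volume.restrict (cube a l)) {x | ENNReal.ofReal t < maximal h x} ≤
      volume (cube a l) * ((if ENNReal.ofReal t < A then ENNReal.ofReal (s * t ^ (s - 1)) else 0) +
       5 ^ n * A * (Ici r).indicator (fun t => ENNReal.ofReal (s * t ^ (s - 2))) t) := by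
    intro t ht
    have ht' : (0 : ℝ) < t := ht
    by_cases htA : ENNReal.ofReal t < A
    · rw [if_pos htA, mul_comm, mul_add]
      refine le_trans ?_ le_self_add
      refine mul_le_mul_left ?_ _
      exact (measure_mono (subset_univ _)).trans_eq (Measure.restrict_apply_univ _)
    · have htr : r ≤ t := by
        rw [hAr, not_lt] at htA; exact (ENNReal.ofReal_le_ofReal_iff ht'.le).1 htA
      rw [if_neg htA, zero_add, indicator_of_mem (by exact htr)]
      have h1 := mul_volume_lt_maximal_le hn h (ENNReal.ofReal t)
      have h3 : ENNReal.ofReal (s * t ^ (s - 1)) =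
          ENNReal.ofReal (s * t ^ (s - 2)) * ENNReal.ofReal t := by
        rw [← ENNReal.ofReal_mul (by positivity), show s - 2 = s - 1 - 1 by ring,
          Real.rpow_sub_one ht'.ne' (s - 1)]
        congr 1
        field_simp
      calc _ ≤ ENNReal.ofReal (s * t ^ (s - 2)) *
            (ENNReal.ofReal t * volume {x | ENNReal.ofReal t < maximal h x}) := by
            rw [h3, mul_assoc]; gcongr; exact Measure.restrict_le_self
        _ ≤ ENNReal.ofReal (s * t ^ (s - 2)) * (5 ^ n * (volume (cube a l) * A)) := by
            rw [hAv]; gcongr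
        _ = _ := by ring
  have hint : ∫⁻ t in Ioi (0 : ℝ), (Ici r).indicator (fun t => ENNReal.ofReal (s * t ^ (s - 2))) t
      = ENNReal.ofReal (s / (1 - s) * r ^ (s - 1)) := by
    rw [setLIntegral_indicator measurableSet_Ici,
      inter_eq_left.2 (Ici_subset_Ioi.2 hr0), ← restrict_Ioi_eq_restrict_Ici,
      ← ofReal_integral_eq_lintegral_ofReal, integral_const_mul,
      integral_Ioi_rpow_of_lt (by linarith) hr0]
    · congr 1
      rw [show s - 2 + 1 = s - 1 by ring]
      have : s - 1 ≠ 0 := by linarith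
      field_simp
      ring
    · exact (integrableOn_Ioi_rpow_of_lt (by linarith) hr0).const_mul s
    · filter_upwards [ae_restrict_mem measurableSet_Ioi] with t ht
      exact mul_nonneg hs.le (Real.rpow_nonneg (hr0.trans ht).le _)
  have hI : ∫⁻ x in cube a l, maximal h x ^ s ≤
      volume (cube a l) * (A ^ s + 5 ^ n * A * ENNReal.ofReal (s / (1 - s) * r ^ (s - 1))) := by
    rw [lintegral_rpow_eq_lintegral_level (measurable_maximal h) hs]
    refine (setLIntegral_mono' measurableSet_Ioi level).trans ?_
    rw [lintegral_const_mul' _ _ hvt, lintegral_add_left, setLIntegral_Ioi_ite_ofReal_lt hs,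
      lintegral_const_mul' _ _ (ENNReal.mul_ne_top (by simp) hAt), hint]
    exact Measurable.ite (measurableSet_lt (by fun_prop) measurable_const) (by fun_prop)
      measurable_const
  have hAs : A * ENNReal.ofReal (s / (1 - s) * r ^ (s - 1)) =
      ENNReal.ofReal (s / (1 - s)) * A ^ s := by
    rw [hAr, ENNReal.ofReal_rpow_of_pos hr0, ← ENNReal.ofReal_mul hr0.le,
      ← ENNReal.ofReal_mul (by positivity), Real.rpow_sub_one hr0.ne']
    congr 1
    field_simp
  calc cubeAverage a l (fun x => maximal h x ^ s)
      ≤ (volume (cube a l))⁻¹ * (volume (cube a l) *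
        (A ^ s + 5 ^ n * A * ENNReal.ofReal (s / (1 - s) * r ^ (s - 1)))) := by
        unfold cubeAverage; gcongr
    _ = A ^ s + 5 ^ n * (A * ENNReal.ofReal (s / (1 - s) * r ^ (s - 1))) := by
        rw [← mul_assoc, ENNReal.inv_mul_cancel hv0 hvt, one_mul, mul_assoc]
    _ = _ := by
        rw [hAs]; push_cast; rw [ENNReal.ofReal]; ring

theorem cubeAverage_mono_on (a : Rn n) (l : ℝ) {f g : Rn n → ℝ≥0∞}
    (h : ∀ x ∈ cube a l, f x ≤ g x) : cubeAverage a l f ≤ cubeAverage a l g :=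
  mul_le_mul_right (setLIntegral_mono' (measurableSet_cube a l) h) _

theorem cubeAverage_const_mul (a : Rn n) (l : ℝ) {c : ℝ≥0∞} (hc : c ≠ ∞) (f : Rn n → ℝ≥0∞) :
    cubeAverage a l (fun x => c * f x) = c * cubeAverage a l f := by
  rw [cubeAverage, lintegral_const_mul' _ _ hc, mul_left_comm]; rfl

/-- Jensen's inequality for averages over cubes. -/
theorem cubeAverage_rpow_le (a : Rn n) {l : ℝ} (hl : 0 < l) {f : Rn n → ℝ≥0∞}
    (hf : AEMeasurable f) {s : ℝ} (hs : 0 ≤ s) (hs1 : s ≤ 1) :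
    cubeAverage a l (fun x => f x ^ s) ≤ cubeAverage a l f ^ s := by
  have h := ENNReal.lintegral_mul_norm_pow_le (μ := volume.restrict (cube a l)) hf.restrict
    (aemeasurable_const (b := (1 : ℝ≥0∞))) hs (sub_nonneg.2 hs1) (by ring)
  simp only [ENNReal.one_rpow, mul_one, lintegral_const, one_mul,
    Measure.restrict_apply_univ] at h
  have hv0 := volume_cube_ne_zero a hl
  have hvt := volume_cube_ne_top a l
  calc cubeAverage a l (fun x => f x ^ s)
      ≤ (volume (cube a l))⁻¹ * ((∫⁻ x in cube a l, f x) ^ s * volume (cube a l) ^ (1 - s)) := by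
        unfold cubeAverage; gcongr
    _ = _ := by
        rw [cubeAverage, ENNReal.mul_rpow_of_nonneg _ _ hs, ENNReal.rpow_sub _ _ hv0 hvt,
          ENNReal.rpow_one, ENNReal.inv_rpow, div_eq_mul_inv, mul_left_comm,
          ← mul_assoc (volume (cube a l))⁻¹, ENNReal.inv_mul_cancel hv0 hvt, one_mul, mul_comm]

theorem cubeAverage_rpow_le_of_le (a : Rn n) {l : ℝ} (hl : 0 < l) {f : Rn n → ℝ≥0∞}
    (hf : AEMeasurable f) {s t : ℝ} (hs : 0 ≤ s) (ht : 0 < t) (hst : s ≤ t) :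
    cubeAverage a l (fun x => f x ^ s) ≤ cubeAverage a l (fun x => f x ^ t) ^ (s / t) := by
  have h := cubeAverage_rpow_le a hl (hf.pow_const t) (div_nonneg hs ht.le)
    ((div_le_one ht).2 hst)
  simpa only [← ENNReal.rpow_mul, mul_div_cancel₀ s ht.ne'] using h

/-- A cube that meets Q and leaves its triple is at least as long as Q, so its own triple contains
Q. The far part of the maximal function is thus nearly constant on Q. -/
theorem maximal_indicator_compl_triple_le (h : Rn n → ℝ≥0∞) {a x y : Rn n} {l : ℝ}
    (hx : x ∈ cube a l) (hy : y ∈ cube a l) :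
    maximal ((cube (shiftCorner a l) (3 * l))ᶜ.indicator h) y ≤ 3 ^ n * maximal h x := by
  refine maximal_le_iff.2 fun b m hm hyb => ?_
  by_cases hsub : cube b m ⊆ cube (shiftCorner a l) (3 * l)
  · have h0 : ∫⁻ z in cube b m, (cube (shiftCorner a l) (3 * l))ᶜ.indicator h z = 0 := by
      rw [setLIntegral_congr_fun (g := 0) (measurableSet_cube b m) fun z hz =>
        indicator_of_notMem (not_not.2 (hsub hz)) h]
      simp
    simp [cubeAverage, h0]
  · obtain ⟨z, hzb, hz⟩ := not_subset.1 hsub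
    have hml : l ≤ m := by
      by_contra! hlt
      refine hz fun i => ?_
      have h1 := hzb i
      have h2 := hyb i
      have h3 := hy i
      simp only [mem_Icc, mem_Ioo, shiftCorner_apply] at *
      constructor <;> linarith
    have hxb : x ∈ openCube (shiftCorner b m) ((3 : ℕ) * m) := fun i => by
      have h1 := hx i
      have h2 := hyb i
      have h3 := hy i
      simp only [mem_Icc, mem_Ioo, shiftCorner_apply] at *
      push_cast
      constructor <;> linarith
    calc _ ≤ cubeAverage b m h := cubeAverage_mono _ _ fun z => indicator_le_self _ _ _
      _ ≤ (3 : ℕ) ^ n * cubeAverage (shiftCorner b m) ((3 : ℕ) * m) h :=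
          cubeAverage_le_of_subset _ _ hm 3 (by norm_num)
            ((cube_subset_triple b hm).trans (openCube_subset_cube _ _)) h
      _ ≤ _ := by
          gcongr
          · simp
          · exact cubeAverage_le_maximal (by positivity) hxb h

/-- The theorem of Coifman and Rochberg: small powers of `h + M h` are `A₁` weights. -/
theorem exists_cubeAverage_add_maximal_rpow_le (hn : 1 ≤ n) {s : ℝ} (hs : 0 < s) (hs1 : s < 1) :
    ∃ D : ℝ≥0, ∀ h : Rn n → ℝ≥0∞, Measurable h → ∀ (a : Rn n) (l : ℝ), 0 < l →
      ∀ x ∈ cube a l, cubeAverage a l (fun y => (h y + maximal h y) ^ s) ≤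
        D * (h x + maximal h x) ^ s := by
  obtain ⟨C, hC⟩ := exists_cubeAverage_maximal_rpow_le hn hs hs1
  refine ⟨(2 + C) * (3 ^ n) ^ s, fun h hh a l hl x hx => ?_⟩
  set T := cube (shiftCorner a l) (3 * l) with hT
  have hTm : MeasurableSet T := measurableSet_cube _ _
  -- The part of `h` in the tripled cube is left to Kolmogorov's inequality; the rest is controlled
  -- by the value of the maximal function at `x`.
  have hsplit : ∀ y ∈ cube a l, (h y + maximal h y) ^ s ≤
      h y ^ s + (maximal (T.indicator h) y ^ s + (3 ^ n * maximal h x) ^ s) := fun y hy => by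
    have h1 : maximal h y ≤ maximal (T.indicator h) y + 3 ^ n * maximal h x := by
      refine (maximal_mono (g := fun z => T.indicator h z + Tᶜ.indicator h z) (fun z => ?_) y).trans
        ((maximal_add_le (hh.indicator hTm).aemeasurable _ y).trans
          (add_le_add le_rfl (maximal_indicator_compl_triple_le h hx hy)))
      rw [indicator_self_add_compl_apply]
    refine (ENNReal.rpow_add_le_add_rpow _ _ hs.le hs1.le).trans (add_le_add le_rfl ?_)
    exact (ENNReal.rpow_le_rpow h1 hs.le).trans (ENNReal.rpow_add_le_add_rpow _ _ hs.le hs1.le)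
  have hA : cubeAverage a l (fun y => h y ^ s) ≤ (3 ^ n * maximal h x) ^ s :=
    (cubeAverage_rpow_le a hl hh.aemeasurable hs.le hs1.le).trans
      (ENNReal.rpow_le_rpow (cubeAverage_le_maximal_of_mem hl hx h) hs.le)
  have hB : cubeAverage a l (fun y => maximal (T.indicator h) y ^ s) ≤
      C * (3 ^ n * maximal h x) ^ s := by
    have hI : ∫⁻ z, T.indicator h z = volume (cube a l) *
        (3 ^ n * cubeAverage (shiftCorner a l) (3 * l) h) := by
      rw [lintegral_indicator hTm, hT, ← cubeAverage_mul_volume _ (by positivity),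
        ENNReal.ofReal_mul (by norm_num), mul_pow, volume_cube]
      norm_num
      ring
    refine (hC _ a l hl).trans (mul_le_mul_right (ENNReal.rpow_le_rpow ?_ hs.le) _)
    rw [hI, ← mul_assoc, ENNReal.inv_mul_cancel (volume_cube_ne_zero a hl)
      (volume_cube_ne_top a l), one_mul]
    gcongr
    exact cubeAverage_le_maximal (by positivity) (by exact_mod_cast cube_subset_triple a hl hx) h
  calc _ ≤ cubeAverage a l (fun y => h y ^ s +
        (maximal (T.indicator h) y ^ s + (3 ^ n * maximal h x) ^ s)) :=
        cubeAverage_mono_on _ _ hsplit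
    _ = cubeAverage a l (fun y => h y ^ s) + (cubeAverage a l
        (fun y => maximal (T.indicator h) y ^ s) + (3 ^ n * maximal h x) ^ s) := by
        rw [cubeAverage_add _ _ (hh.pow_const s).aemeasurable,
          cubeAverage_add _ _ ((measurable_maximal _).pow_const s).aemeasurable,
          cubeAverage_const a hl]
    _ ≤ (3 ^ n * maximal h x) ^ s + (C * (3 ^ n * maximal h x) ^ s +
        (3 ^ n * maximal h x) ^ s) := by gcongr
    _ = ((2 + C) * (3 ^ n) ^ s) * maximal h x ^ s := by
        rw [ENNReal.mul_rpow_of_nonneg _ _ hs.le]; ring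
    _ ≤ _ := by
        push_cast
        rw [ENNReal.coe_rpow_of_nonneg _ hs.le]
        push_cast
        gcongr
        exact le_add_self

/-! ### From constant to variable powers under log-Hölder continuity. -/

/-- The quotient of the powers is exp((s - t) log r). Both log-Hölder conditions act only by
bounding this product of an oscillation and a logarithm. -/
theorem rpow_le_exp_mul_rpow {r M K s t : ℝ} (hr : 0 < r) (hM : |Real.log r| ≤ M)
    (hK : |s - t| * M ≤ K) :
    ENNReal.ofReal r ^ s ≤ ENNReal.ofReal (Real.exp K) * ENNReal.ofReal r ^ t := by
  rw [ENNReal.ofReal_rpow_of_pos hr, ENNReal.ofReal_rpow_of_pos hr,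
    ← ENNReal.ofReal_mul (Real.exp_pos _).le]
  refine ENNReal.ofReal_le_ofReal ?_
  rw [Real.rpow_def_of_pos hr, Real.rpow_def_of_pos hr, ← Real.exp_add, Real.exp_le_exp]
  have h1 : Real.log r * (s - t) ≤ M * |s - t| :=
    (le_abs_self _).trans (by rw [abs_mul]; gcongr)
  linarith

theorem one_le_log_exp_one_add {t : ℝ} (ht : 0 ≤ t) : 1 ≤ Real.log (Real.exp 1 + t) := by
  rw [Real.le_log_iff_exp_le (by positivity)]; linarith

/-- Below `1` and above a power of `1 + ‖x‖`, log-Hölder decay allows a change of exponent. -/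
theorem rpow_le_of_decay {E : Type*} [SeminormedAddCommGroup E] {x : E} {v : ℝ≥0∞}
    {N c s t : ℝ} (hN : 0 ≤ N)
    (hv : ENNReal.ofReal ((1 + ‖x‖) ^ (-N)) ≤ v) (hv1 : v ≤ 1)
    (hst : |s - t| ≤ c * (1 / Real.log (Real.exp 1 + ‖x‖))) :
    v ^ s ≤ ENNReal.ofReal (Real.exp (N * c)) * v ^ t := by
  have hvt : v ≠ ∞ := (hv1.trans_lt ENNReal.one_lt_top).ne
  have hx := norm_nonneg x
  set Λ := Real.log (Real.exp 1 + ‖x‖) with hΛ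
  have hΛ1 : 1 ≤ Λ := one_le_log_exp_one_add hx
  have hr1 : v.toReal ≤ 1 := by simpa using ENNReal.toReal_mono ENNReal.one_ne_top hv1
  have hr : (1 + ‖x‖) ^ (-N) ≤ v.toReal := (ENNReal.ofReal_le_iff_le_toReal hvt).1 hv
  have hpos : 0 < (1 + ‖x‖) ^ (-N) := by positivity
  have hlog : |Real.log v.toReal| ≤ N * Λ := by
    rw [abs_of_nonpos (Real.log_nonpos (by positivity) hr1), neg_le]
    have h1 := Real.log_le_log hpos hr
    rw [Real.log_rpow (by positivity)] at h1
    have h2 : Real.log (1 + ‖x‖) ≤ Λ :=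
      Real.log_le_log (by positivity) (by linarith [Real.add_one_le_exp (1 : ℝ)])
    nlinarith
  rw [← ENNReal.ofReal_toReal hvt]
  refine rpow_le_exp_mul_rpow (hpos.trans_le hr) hlog ?_
  calc |s - t| * (N * Λ) ≤ c * (1 / Λ) * (N * Λ) := by gcongr
    _ = N * c := by field_simp

theorem norm_sub_le_of_mem_cube {a x y : Rn n} {l : ℝ} (hx : x ∈ cube a l) (hy : y ∈ cube a l) :
    ‖x - y‖ ≤ n * l := by
  have h1 : ∀ i, |(x - y) i| ≤ l := fun i => by
    have h2 := hx i
    have h3 := hy i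
    simp only [mem_Icc, PiLp.sub_apply] at *
    rw [abs_le]; constructor <;> linarith
  have h2 : ‖x - y‖ ≤ ∑ i : Fin n, |(x - y) i| := by
    rw [EuclideanSpace.norm_eq]
    refine Real.sqrt_le_iff.2 ⟨by positivity, ?_⟩
    simp only [Real.norm_eq_abs]
    exact Finset.sum_sq_le_sq_sum_of_nonneg fun i _ => abs_nonneg _
  exact h2.trans ((Finset.sum_le_sum fun i _ => h1 i).trans (by simp))

theorem abs_sub_le_of_mem_cube {σ : Rn n → ℝ} {c : ℝ} (hn : 1 ≤ n) (hc : 0 < c)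
    (hσ : ∀ x y, |σ x - σ y| ≤ c * (1 / Real.log (Real.exp 1 + 1 / ‖x - y‖)))
    {a x y : Rn n} {l : ℝ} (hl : 0 < l) (hx : x ∈ cube a l) (hy : y ∈ cube a l) :
    |σ x - σ y| ≤ c * (1 / Real.log (Real.exp 1 + 1 / (n * l))) := by
  have hn' : (0 : ℝ) < n := by exact_mod_cast hn
  have h0 : 0 < Real.log (Real.exp 1 + 1 / (n * l)) :=
    zero_lt_one.trans_le (one_le_log_exp_one_add (by positivity))
  -- At x = y the convention `1 / 0 = 0` turns the bound into `c`, so monotonicity in the distance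
  -- is unavailable there.
  rcases eq_or_ne x y with rfl | hxy
  · simp only [sub_self, abs_zero]; positivity
  have hd : 0 < ‖x - y‖ := norm_pos_iff.2 (sub_ne_zero.2 hxy)
  refine (hσ x y).trans ?_
  gcongr
  exact norm_sub_le_of_mem_cube hx hy

/-- A variable power, with log-Hölder continuous exponent, of a suitable function inherits the
`A₁` condition from its largest constant power. -/
theorem exists_cubeAverage_rpow_variable_le (hn : 1 ≤ n) {σ : Rn n → ℝ} {σm σp : ℝ}
    (hσm : 0 < σm) (hσ : ∀ x, σ x ∈ Icc σm σp) (hloc : LocallyLogHolder σ)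
    (hdec : ∃ s c : ℝ, ∀ x, |σ x - s| ≤ c * (1 / Real.log (Real.exp 1 + ‖x‖)))
    {N q : ℝ} (hN : 0 ≤ N) (hq : 0 < q) (B D : ℝ≥0) :
    ∃ C : ℝ≥0, ∀ V : Rn n → ℝ≥0∞, Measurable V →
      (∀ (a : Rn n) (l : ℝ), 0 < l → ∀ x ∈ cube a l,
        cubeAverage a l (fun y => V y ^ σp) ≤ D * V x ^ σp) →
      ∫⁻ x, V x ^ q ≤ B → (∀ x, ENNReal.ofReal ((1 + ‖x‖) ^ (-N)) ≤ V x) →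
      ∀ (a : Rn n) (l : ℝ), 0 < l → ∀ x ∈ cube a l,
        cubeAverage a l (fun y => V y ^ σ y) ≤ C * V x ^ σ x := by
  obtain ⟨c₁, hc₁, hloc⟩ := hloc
  have hσp : 0 < σp := hσm.trans_le ((hσ 0).1.trans (hσ 0).2)
  have hmp : σm ≤ σp := (hσ 0).1.trans (hσ 0).2
  -- Projecting the limiting exponent onto [σm, σp] brings it no farther from any value of `σ`, and
  -- makes the averages of V^τ accessible by Jensen.
  obtain ⟨τ, c₂, hτ, hdec⟩ : ∃ τ c : ℝ, τ ∈ Icc σm σp ∧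
      ∀ x, |σ x - τ| ≤ c * (1 / Real.log (Real.exp 1 + ‖x‖)) := by
    obtain ⟨s, c, h⟩ := hdec
    refine ⟨max σm (min σp s), c, ⟨le_max_left _ _, max_le hmp (min_le_left _ _)⟩,
      fun x => le_trans ?_ (h x)⟩
    have h1 := hσ x
    rcases le_total s σm with h2 | h2
    · rw [max_eq_left ((min_le_right _ _).trans h2), abs_of_nonneg (by linarith [h1.1]),
        abs_of_nonneg (by linarith [h1.1])]
      linarith
    rcases le_total s σp with h3 | h3
    · rw [min_eq_right h3, max_eq_right h2]
    · rw [min_eq_left h3, max_eq_right hmp, abs_of_nonpos (by linarith [h1.2]),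
        abs_of_nonpos (by linarith [h1.2])]
      linarith
  set L : ℝ≥0 := (Real.exp (N * c₂)).toNNReal
  set B' : ℝ := B + 1
  have hB'1 : 1 ≤ B' := by simp [B']
  set M : ℝ := (Real.log B' + n * Real.log n + n) / q with hMdef
  set K : ℝ := c₁ * M with hK
  set R : ℝ≥0 := (Real.exp K).toNNReal
  have hn' : (1 : ℝ) ≤ n := by exact_mod_cast hn
  have hlogn : 0 ≤ Real.log n := Real.log_nonneg hn'
  have hlogB : 0 ≤ Real.log B' := Real.log_nonneg hB'1
  have hM0 : 0 ≤ M := by positivity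
  have hL1 : ∀ (y : Rn n) (v : ℝ≥0∞), ENNReal.ofReal ((1 + ‖y‖) ^ (-N)) ≤ v → v ≤ 1 →
      v ^ σ y ≤ L * v ^ τ ∧ v ^ τ ≤ L * v ^ σ y := fun y v h1 h2 =>
    ⟨rpow_le_of_decay hN h1 h2 (hdec y), rpow_le_of_decay hN h1 h2 (by
      rw [abs_sub_comm]; exact hdec y)⟩
  refine ⟨(L + 1) * (2 * (D + 1)) * L + (D + 1) * R, fun V hV hA1 hint hlow => ?_⟩
  -- By Jensen the A₁ condition passes to all smaller powers; D + 1 bounds D^(t/σp) uniformly in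
  -- `t`.
  have hJ : ∀ t : ℝ, 0 ≤ t → t ≤ σp → ∀ (a : Rn n) (l : ℝ), 0 < l → ∀ x ∈ cube a l,
      cubeAverage a l (fun y => V y ^ t) ≤ (D + 1) * V x ^ t := fun t ht0 ht a l hl x hx => by
    refine (cubeAverage_rpow_le_of_le a hl hV.aemeasurable ht0 hσp ht).trans ?_
    refine (ENNReal.rpow_le_rpow (hA1 a l hl x hx) (by positivity)).trans ?_
    rw [ENNReal.mul_rpow_of_nonneg _ _ (by positivity), ← ENNReal.rpow_mul,
      mul_div_cancel₀ t hσp.ne']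
    gcongr
    calc (D : ℝ≥0∞) ^ (t / σp) ≤ ((D : ℝ≥0∞) + 1) ^ (t / σp) := by gcongr; exact le_self_add
      _ ≤ ((D : ℝ≥0∞) + 1) ^ (1 : ℝ) :=
        ENNReal.rpow_le_rpow_of_exponent_le le_add_self ((div_le_one hσp).2 ht)
      _ = _ := ENNReal.rpow_one _
  intro a l hl x hx
  -- cubes on which `V` is somewhere at most one
  have small : ∀ z ∈ cube a l, V z ≤ 1 → cubeAverage a l (fun y => V y ^ σ y) ≤
      (L + 1) * (2 * (D + 1)) * L * V z ^ σ z := fun z hz hz1 => by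
    have h1 : ∀ y, V y ^ σ y ≤ (L + 1) * (V y ^ τ + V y ^ σp) := fun y => by
      rcases le_total (V y) 1 with h | h
      · refine (hL1 y _ (hlow y) h).1.trans ?_
        gcongr <;> exact le_self_add
      · calc V y ^ σ y ≤ V y ^ σp := ENNReal.rpow_le_rpow_of_exponent_le h (hσ y).2
          _ ≤ 1 * (V y ^ τ + V y ^ σp) := by rw [one_mul]; exact le_add_self
          _ ≤ _ := by gcongr; exact le_add_self
    calc _ ≤ cubeAverage a l (fun y => (L + 1) * (V y ^ τ + V y ^ σp)) := cubeAverage_mono _ _ h1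
      _ = (L + 1) * (cubeAverage a l (fun y => V y ^ τ) +
          cubeAverage a l (fun y => V y ^ σp)) := by
        rw [cubeAverage_const_mul _ _ (by simp), cubeAverage_add _ _ (hV.pow_const τ).aemeasurable]
      _ ≤ (L + 1) * ((D + 1) * V z ^ τ + (D + 1) * V z ^ τ) := by
        gcongr
        · exact hJ τ (hσm.le.trans hτ.1) hτ.2 a l hl z hz
        · exact (hJ σp hσp.le le_rfl a l hl z hz).trans
            (mul_le_mul_right (ENNReal.rpow_le_rpow_of_exponent_ge hz1 hτ.2) _)
      _ = (L + 1) * (2 * (D + 1)) * V z ^ τ := by ring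
      _ ≤ (L + 1) * (2 * (D + 1)) * (L * V z ^ σ z) := by
        gcongr
        exact (hL1 z _ (hlow z) hz1).2
      _ = _ := by ring
  push_cast
  rw [add_mul]
  by_cases hx1 : V x ≤ 1
  · exact (small x hx hx1).trans le_self_add
  rw [not_le] at hx1
  -- If V z ≤ 1 < V x, the bound at `z` passes to `x`, as V(z)^σ(z) ≤ 1 ≤ V(x)^σ(x).
  by_cases hex : ∃ z ∈ cube a l, V z ≤ 1
  · obtain ⟨z, hz, hz1⟩ := hex
    refine (small z hz hz1).trans (le_trans ?_ le_self_add)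
    gcongr
    exact (ENNReal.rpow_le_one hz1 (hσm.le.trans (hσ z).1)).trans
      (ENNReal.one_le_rpow hx1.le (hσm.trans_le (hσ x).1))
  push Not at hex
  refine le_trans ?_ le_add_self
  -- Now V > 1 on the whole cube. The value at `x` may be too large for a change of exponent, so the
  -- change is made at a point where V^q is at most B/|Q|, chosen with V z ≤ V x to allow the return
  -- to `x`.
  obtain ⟨z, hz, hzx, hzB⟩ : ∃ z ∈ cube a l, V z ≤ V x ∧ V z ^ q ≤ B / ENNReal.ofReal l ^ n := by
    obtain ⟨w, hw, hwle⟩ := exists_le_setLAverage (μ := volume) (s := cube a l)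
      (f := fun y => V y ^ q) (volume_cube_ne_zero a hl) (volume_cube_ne_top a l)
      (hV.pow_const q).aemeasurable
    have hwB : V w ^ q ≤ B / ENNReal.ofReal l ^ n := by
      refine hwle.trans ?_
      rw [setLAverage_eq, volume_cube]
      gcongr
      exact (setLIntegral_le_lintegral _ _).trans hint
    rcases le_total (V w) (V x) with h | h
    · exact ⟨w, hw, h, hwB⟩
    · exact ⟨x, hx, le_rfl, (ENNReal.rpow_le_rpow h hq.le).trans hwB⟩
  have hz1 := hex z hz
  set Λ := Real.log (Real.exp 1 + 1 / (n * l)) with hΛ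
  have hnl : 0 < n * l := by positivity
  have hΛ1 : 1 ≤ Λ := one_le_log_exp_one_add (by positivity)
  have hl0 : ENNReal.ofReal l ^ n ≠ 0 := pow_ne_zero _ (by simpa using hl)
  have hBl : (B : ℝ≥0∞) / ENNReal.ofReal l ^ n ≠ ∞ := ENNReal.div_ne_top ENNReal.coe_ne_top hl0
  have hzt : V z ≠ ∞ := fun h => by
    rw [h, ENNReal.top_rpow_of_pos hq] at hzB
    exact hBl (top_le_iff.1 hzB)
  have hr1 : 1 ≤ (V z).toReal := by simpa using ENNReal.toReal_mono hzt hz1.le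
  have hr0 : 0 < (V z).toReal := by linarith
  have hlog : |Real.log (V z).toReal| ≤ M * Λ := by
    rw [abs_of_nonneg (Real.log_nonneg hr1)]
    have h1 := ENNReal.toReal_mono hBl hzB
    rw [← ENNReal.toReal_rpow, ENNReal.toReal_div, ENNReal.toReal_pow,
      ENNReal.toReal_ofReal hl.le, ENNReal.coe_toReal] at h1
    have h2 : (V z).toReal ^ q ≤ B' * (1 / (n * l)) ^ n * n ^ n := by
      refine h1.trans ?_
      rw [mul_assoc, ← mul_pow, show 1 / (n * l) * n = l⁻¹ by field_simp, inv_pow,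
        div_eq_mul_inv]
      gcongr
      simp [B']
    have h3 := Real.log_le_log (by positivity) h2
    rw [Real.log_rpow hr0, Real.log_mul (by positivity) (by positivity),
      Real.log_mul (by positivity) (by positivity), Real.log_pow, Real.log_pow] at h3
    have h4 : Real.log (1 / (n * l)) ≤ Λ :=
      Real.log_le_log (by positivity) (by linarith [Real.exp_pos 1])
    have h5 : (n : ℝ) * Real.log (1 / (n * l)) ≤ n * Λ := by gcongr
    have h6 : Real.log B' + n * Real.log n ≤ (Real.log B' + n * Real.log n) * Λ :=
      le_mul_of_one_le_right (by positivity) hΛ1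
    rw [hMdef, div_mul_eq_mul_div, le_div_iff₀ hq]
    linarith
  set ω := c₁ * (1 / Λ) with hω
  have hω0 : 0 ≤ ω := by positivity
  -- A constant exponent dominating `σ` on the cube, cut off at `σp` so that `hJ` applies.
  set S := min σp (σ x + ω) with hS
  have hSx : σ x ≤ S := le_min (hσ x).2 (by linarith)
  have hS0 : 0 ≤ S := (hσm.le.trans (hσ x).1).trans hSx
  have hchange : V z ^ S ≤ R * V z ^ σ x := by
    rw [← ENNReal.ofReal_toReal hzt]
    refine rpow_le_exp_mul_rpow hr0 hlog ?_
    rw [abs_of_nonneg (by linarith)]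
    have : S - σ x ≤ ω := by have := min_le_right σp (σ x + ω); linarith
    calc (S - σ x) * (M * Λ) ≤ ω * (M * Λ) := by gcongr
      _ = K := by rw [hω, hK]; field_simp
  calc _ ≤ cubeAverage a l (fun y => V y ^ S) := by
        refine cubeAverage_mono_on _ _ fun y hy =>
          ENNReal.rpow_le_rpow_of_exponent_le (hex y hy).le (le_min (hσ y).2 ?_)
        have := (abs_le.1 (abs_sub_le_of_mem_cube hn hc₁ hloc hl hx hy)).1
        linarith
    _ ≤ (D + 1) * V z ^ S := hJ S hS0 (min_le_left _ _) a l hl z hz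
    _ ≤ (D + 1) * (R * V z ^ σ x) := by gcongr
    _ ≤ (D + 1) * (R * V x ^ σ x) := by
        gcongr
        exact hσm.le.trans (hσ x).1
    _ = _ := by ring

/-! ### A_{p₀} weights from variable powers of one function. -/

theorem cubeAverage_mono_ae (a : Rn n) (l : ℝ) {f g : Rn n → ℝ≥0∞}
    (h : ∀ᵐ x, x ∈ cube a l → f x ≤ g x) : cubeAverage a l f ≤ cubeAverage a l g :=
  mul_le_mul_right (setLIntegral_mono_ae' (measurableSet_cube a l) h) _

theorem cubeAverage_mul_const (a : Rn n) (l : ℝ) {c : ℝ≥0∞} (hc : c ≠ ∞) (f : Rn n → ℝ≥0∞) :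
    cubeAverage a l (fun x => f x * c) = cubeAverage a l f * c := by
  simp_rw [mul_comm _ c]; exact cubeAverage_const_mul a l hc f

theorem cubeAverage_ne_zero (a : Rn n) {l : ℝ} (hl : 0 < l) {f : Rn n → ℝ≥0∞}
    (hf : Measurable f) (h0 : ∀ᵐ x, f x ≠ 0) : cubeAverage a l f ≠ 0 := by
  refine mul_ne_zero (ENNReal.inv_ne_zero.2 (volume_cube_ne_top a l)) fun h => ?_
  rw [lintegral_eq_zero_iff hf] at h
  have h1 : ∀ᵐ x ∂volume.restrict (cube a l), False := by
    filter_upwards [h, ae_restrict_of_ae h0] with x hx hx' using hx' hx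
  rw [Filter.eventually_false_iff_eq_bot, ae_eq_bot, Measure.restrict_eq_zero] at h1
  exact volume_cube_ne_zero a hl h1

theorem cube_mem_nhds (x : Rn n) : cube (shiftCorner x 1) 2 ∈ nhds x :=
  Filter.mem_of_superset ((isOpen_openCube (shiftCorner x 1) 2).mem_nhds fun i => by
    simp only [mem_Ioo, shiftCorner_apply]; constructor <;> linarith) (openCube_subset_cube _ _)

theorem isWeight_of_cubeAverage_ne_top {w : Rn n → ℝ≥0} (hw : Measurable w)
    (h : ∀ (a : Rn n) (l : ℝ), 0 < l → cubeAverage a l (fun x => w x) ≠ ∞) : IsWeight w := by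
  intro x
  refine ⟨_, cube_mem_nhds x, hw.coe_nnreal_real.aestronglyMeasurable, ?_⟩
  have h1 := cubeAverage_mul_volume (shiftCorner x 1) (l := 2) (by norm_num) (fun x => w x)
  have h2 : cubeAverage (shiftCorner x 1) 2 (fun x => w x) * ENNReal.ofReal 2 ^ n < ∞ :=
    ENNReal.mul_lt_top (h _ _ (by norm_num)).lt_top (by simp)
  rw [h1] at h2
  simpa [hasFiniteIntegral_iff_enorm, NNReal.enorm_eq, Real.enorm_eq_ofReal] using h2

/-- The easy half of the factorization theorem, for two variable powers of one function. -/
theorem isApWeight_of_variable_rpow {p₀ : ℝ} (hp₀ : 1 < p₀) {T : Rn n → ℝ≥0∞}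
    (hT : Measurable T) (hT0 : ∀ x, T x ≠ 0) (hTt : ∀ᵐ x, T x ≠ ∞) {s : Rn n → ℝ}
    (hs : Measurable s) {C : ℝ≥0}
    (h1 : ∀ (a : Rn n) (l : ℝ), 0 < l → ∀ x ∈ cube a l,
      cubeAverage a l (fun y => T y ^ s y) ≤ C * T x ^ s x)
    (h2 : ∀ (a : Rn n) (l : ℝ), 0 < l → ∀ x ∈ cube a l,
      cubeAverage a l (fun y => T y ^ (1 - s y)) ≤ C * T x ^ (1 - s x)) :
    IsApWeight p₀ (C ^ p₀) (fun x => (T x ^ (p₀ * s x - (p₀ - 1))).toNNReal) := by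
  have hp1 : 0 < p₀ - 1 := by linarith
  have hne : ∀ (x : Rn n) (e : ℝ), T x ≠ ∞ → T x ^ e ≠ ∞ := fun x e h =>
    ENNReal.rpow_ne_top_of_ne_zero (hT0 x) h
  have hw : ∀ᵐ x, (((T x ^ (p₀ * s x - (p₀ - 1))).toNNReal : ℝ≥0) : ℝ≥0∞) =
      T x ^ (p₀ * s x - (p₀ - 1)) := by
    filter_upwards [hTt] with x hx using ENNReal.coe_toNNReal (hne x _ hx)
  have hmem : ∀ (a : Rn n) (l : ℝ), 0 < l → ∃ x ∈ cube a l, T x ≠ ∞ := fun a l hl => by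
    have h : ∃ᵐ x, x ∈ cube a l :=
      frequently_ae_mem_iff.2 (volume_cube_ne_zero a hl)
    obtain ⟨x, hx, hx'⟩ := (h.and_eventually hTt).exists
    exact ⟨x, hx, hx'⟩
  have fin : ∀ (a : Rn n) (l : ℝ), 0 < l → cubeAverage a l (fun y => T y ^ s y) ≠ ∞ ∧
      cubeAverage a l (fun y => T y ^ (1 - s y)) ≠ ∞ := fun a l hl => by
    obtain ⟨x, hx, hxt⟩ := hmem a l hl
    exact ⟨ne_top_of_le_ne_top (ENNReal.mul_ne_top ENNReal.coe_ne_top (hne x _ hxt)) (h1 a l hl x hx),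
      ne_top_of_le_ne_top (ENNReal.mul_ne_top ENNReal.coe_ne_top (hne x _ hxt)) (h2 a l hl x hx)⟩
  have hpos : ∀ e : Rn n → ℝ, ∀ᵐ x, T x ^ e x ≠ 0 := fun e => by
    filter_upwards [hTt] with x hx using (ENNReal.rpow_pos (pos_iff_ne_zero.2 (hT0 x)) hx).ne'
  have pos1 : ∀ (a : Rn n) (l : ℝ), 0 < l → cubeAverage a l (fun y => T y ^ s y) ≠ 0 :=
    fun a l hl => cubeAverage_ne_zero a hl (hT.pow hs) (hpos s)
  have pos2 : ∀ (a : Rn n) (l : ℝ), 0 < l → cubeAverage a l (fun y => T y ^ (1 - s y)) ≠ 0 :=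
    fun a l hl => cubeAverage_ne_zero a hl (hT.pow (hs.const_sub 1)) (hpos _)
  -- The A₁ bound for T^(1-s) is inserted pointwise, reducing the weight to T^s; `key2` does the
  -- same for the dual power with the roles exchanged. In their product the two averages cancel.
  have key1 : ∀ (a : Rn n) (l : ℝ), 0 < l →
      cubeAverage a l (fun x => ((T x ^ (p₀ * s x - (p₀ - 1))).toNNReal : ℝ≥0∞)) *
        cubeAverage a l (fun y => T y ^ (1 - s y)) ^ (p₀ - 1) ≤
      C ^ (p₀ - 1) * cubeAverage a l (fun y => T y ^ s y) := fun a l hl => by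
    rw [← cubeAverage_mul_const _ _ (ENNReal.rpow_ne_top_of_nonneg hp1.le (fin a l hl).2),
      ← cubeAverage_const_mul _ _ (ENNReal.rpow_ne_top_of_nonneg hp1.le ENNReal.coe_ne_top)]
    refine cubeAverage_mono_ae _ _ ?_
    filter_upwards [hTt, hw] with x hxt hxw hx
    rw [hxw]
    calc _ ≤ T x ^ (p₀ * s x - (p₀ - 1)) * (C * T x ^ (1 - s x)) ^ (p₀ - 1) := by
          gcongr
          exact h2 a l hl x hx
      _ = C ^ (p₀ - 1) *
          (T x ^ (p₀ * s x - (p₀ - 1)) * T x ^ ((1 - s x) * (p₀ - 1))) := by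
          rw [ENNReal.mul_rpow_of_nonneg _ _ hp1.le, ← ENNReal.rpow_mul]; ring
      _ = _ := by
          rw [← ENNReal.rpow_add _ _ (hT0 x) hxt]; congr 2; ring
  have key2 : ∀ (a : Rn n) (l : ℝ), 0 < l →
      cubeAverage a l (fun x =>
        ((T x ^ (p₀ * s x - (p₀ - 1))).toNNReal : ℝ≥0∞) ^ (1 - p₀.conjExponent)) ^ (p₀ - 1) *
        cubeAverage a l (fun y => T y ^ s y) ≤
      C * cubeAverage a l (fun y => T y ^ (1 - s y)) ^ (p₀ - 1) := fun a l hl => by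
    have hi : 0 ≤ (p₀ - 1)⁻¹ := by positivity
    have h : cubeAverage a l (fun x =>
        ((T x ^ (p₀ * s x - (p₀ - 1))).toNNReal : ℝ≥0∞) ^ (1 - p₀.conjExponent)) *
        cubeAverage a l (fun y => T y ^ s y) ^ (p₀ - 1)⁻¹ ≤
        (C : ℝ≥0∞) ^ (p₀ - 1)⁻¹ * cubeAverage a l (fun y => T y ^ (1 - s y)) := by
      rw [← cubeAverage_mul_const _ _ (ENNReal.rpow_ne_top_of_nonneg hi (fin a l hl).1),
        ← cubeAverage_const_mul _ _ (ENNReal.rpow_ne_top_of_nonneg hi ENNReal.coe_ne_top)]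
      refine cubeAverage_mono_ae _ _ ?_
      filter_upwards [hTt, hw] with x hxt hxw hx
      rw [hxw]
      calc _ ≤ (T x ^ (p₀ * s x - (p₀ - 1))) ^ (1 - p₀.conjExponent) *
            (C * T x ^ s x) ^ (p₀ - 1)⁻¹ := by
            gcongr
            exact h1 a l hl x hx
        _ = (C : ℝ≥0∞) ^ (p₀ - 1)⁻¹ *
            (T x ^ ((p₀ * s x - (p₀ - 1)) * (1 - p₀.conjExponent)) *
              T x ^ (s x * (p₀ - 1)⁻¹)) := by
            rw [ENNReal.mul_rpow_of_nonneg _ _ hi, ← ENNReal.rpow_mul, ← ENNReal.rpow_mul]; ring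
        _ = _ := by
            rw [← ENNReal.rpow_add _ _ (hT0 x) hxt]
            congr 2
            rw [Real.conjExponent]
            field_simp
            ring
    have h' := ENNReal.rpow_le_rpow h hp1.le
    rwa [ENNReal.mul_rpow_of_nonneg _ _ hp1.le, ENNReal.mul_rpow_of_nonneg _ _ hp1.le,
      ← ENNReal.rpow_mul, ← ENNReal.rpow_mul, inv_mul_cancel₀ hp1.ne', ENNReal.rpow_one,
      ENNReal.rpow_one] at h'
  refine ⟨isWeight_of_cubeAverage_ne_top (by fun_prop) fun a l hl h => ?_, fun a l hl => ?_⟩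
  · have h3 := key1 a l hl
    have hz : cubeAverage a l (fun y => T y ^ (1 - s y)) ^ (p₀ - 1) ≠ 0 :=
      (ENNReal.rpow_pos (pos_iff_ne_zero.2 (pos2 a l hl)) (fin a l hl).2).ne'
    rw [h, ENNReal.top_mul hz, top_le_iff] at h3
    exact ENNReal.mul_ne_top (ENNReal.rpow_ne_top_of_nonneg hp1.le ENNReal.coe_ne_top)
      (fin a l hl).1 h3
  · set A₁ := cubeAverage a l (fun y => T y ^ s y)
    set A₂ := cubeAverage a l (fun y => T y ^ (1 - s y)) ^ (p₀ - 1)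
    have hA : A₂ * A₁ ≠ 0 := mul_ne_zero
      (ENNReal.rpow_pos (pos_iff_ne_zero.2 (pos2 a l hl)) (fin a l hl).2).ne' (pos1 a l hl)
    have hAt : A₂ * A₁ ≠ ∞ := ENNReal.mul_ne_top
      (ENNReal.rpow_ne_top_of_nonneg hp1.le (fin a l hl).2) (fin a l hl).1
    rw [← ENNReal.mul_le_mul_iff_left hA hAt, mul_mul_mul_comm]
    refine (mul_le_mul' (key1 a l hl) (key2 a l hl)).trans_eq ?_
    have hC : (C : ℝ≥0∞) ^ (p₀ - 1) * C = ((C ^ p₀ : ℝ≥0) : ℝ≥0∞) := by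

      have := ENNReal.rpow_add_of_nonneg (x := (C : ℝ≥0∞)) _ _ hp1.le zero_le_one
      rw [sub_add_cancel, ENNReal.rpow_one] at this
      rw [ENNReal.coe_rpow_of_nonneg _ (by linarith : 0 ≤ p₀), this]
    rw [← hC]
    ring

theorem LocallyLogHolder.div_const {s : Rn n → ℝ} (h : LocallyLogHolder s) {θ : ℝ} (hθ : 0 < θ) :
    LocallyLogHolder fun x => s x / θ := by
  obtain ⟨c, hc, h⟩ := h
  refine ⟨c / θ, by positivity, fun x y => ?_⟩
  rw [← sub_div, abs_div, abs_of_pos hθ, div_mul_eq_mul_div]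
  gcongr
  exact h x y

theorem LocallyLogHolder.one_sub {s : Rn n → ℝ} (h : LocallyLogHolder s) :
    LocallyLogHolder fun x => 1 - s x := by
  obtain ⟨c, hc, h⟩ := h
  refine ⟨c, hc, fun x y => ?_⟩
  rw [sub_sub_sub_cancel_left, abs_sub_comm]
  exact h x y

/-- Every integrable function bounded below by a fixed power has an integrable majorant a
variable power of which is an `A_{p₀}` weight. -/
theorem exists_majorant_isApWeight (hn : 1 ≤ n) {p₀ : ℝ} (hp₀ : 1 < p₀) {s : Rn n → ℝ}
    (hsm : Measurable s) {s₀ s₁ : ℝ} (hs₀ : 0 < s₀) (hs₁ : s₁ < 1) (hs : ∀ x, s x ∈ Icc s₀ s₁)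
    (hloc : LocallyLogHolder s)
    (hdec : ∃ t c : ℝ, ∀ x, |s x - t| ≤ c * (1 / Real.log (Real.exp 1 + ‖x‖)))
    {N : ℝ} (hN : 0 ≤ N) (B : ℝ≥0) :
    ∃ K C : ℝ≥0, ∀ U : Rn n → ℝ≥0∞, Measurable U → ∫⁻ x, U x ≤ B →
      (∀ x, ENNReal.ofReal ((1 + ‖x‖) ^ (-N)) ≤ U x) →
      ∃ T : Rn n → ℝ≥0∞, Measurable T ∧ (∀ x, U x ≤ T x) ∧ ∫⁻ x, T x ≤ C ∧
        IsApWeight p₀ K (fun x => (T x ^ (p₀ * s x - (p₀ - 1))).toNNReal) := by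
  set m := max s₁ (1 - s₀) with hm
  have hs01 : s₀ ≤ s₁ := (hs 0).1.trans (hs 0).2
  have hm1 : m < 1 := max_lt hs₁ (by linarith)
  have hm0 : 0 < m := lt_max_of_lt_left (hs₀.trans_le hs01)
  -- Any θ strictly between `m` and 1 serves: m/θ < 1 is needed for Coifman–Rochberg, 1/θ > 1 for
  -- the strong type inequality.
  set θ := (1 + m) / 2 with hθ
  have hθ0 : 0 < θ := by positivity
  have hθ1 : θ < 1 := by linarith
  have hmθ : m < θ := by linarith
  have hq : 1 < θ⁻¹ := (one_lt_inv₀ hθ0).2 hθ1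
  have hσp : m / θ < 1 := (div_lt_one hθ0).2 hmθ
  have hσm : 0 < min s₀ (1 - s₁) / θ := div_pos (lt_min hs₀ (by linarith)) hθ0
  obtain ⟨C₁, hC₁⟩ := exists_lintegral_maximal_rpow_le hn hq
  obtain ⟨D, hD⟩ := exists_cubeAverage_add_maximal_rpow_le hn (div_pos hm0 hθ0) hσp
  set C : ℝ≥0 := 2 ^ (θ⁻¹ - 1) * ((1 + C₁) * B) with hC
  have hdiv : ∀ {u : Rn n → ℝ}, (∃ t c : ℝ, ∀ x, |u x - t| ≤ c * (1 / Real.log (Real.exp 1 + ‖x‖)))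
      → ∃ t c : ℝ, ∀ x, |u x / θ - t| ≤ c * (1 / Real.log (Real.exp 1 + ‖x‖)) := by
    rintro u ⟨t, c, h⟩
    refine ⟨t / θ, c / θ, fun x => ?_⟩
    rw [← sub_div, abs_div, abs_of_pos hθ0, div_mul_eq_mul_div]
    gcongr
    exact h x
  obtain ⟨E₁, hE₁⟩ := exists_cubeAverage_rpow_variable_le hn (σ := fun x => s x / θ)
    (σp := m / θ) hσm
    (fun x => ⟨by gcongr; exact (min_le_left _ _).trans (hs x).1,
      by gcongr; exact (hs x).2.trans (le_max_left _ _)⟩)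
    (hloc.div_const hθ0) (hdiv hdec) (mul_nonneg hN hθ0.le) (inv_pos.2 hθ0) C D
  obtain ⟨E₂, hE₂⟩ := exists_cubeAverage_rpow_variable_le hn (σ := fun x => (1 - s x) / θ)
    (σp := m / θ) hσm
    (fun x => ⟨by gcongr; exact (min_le_right _ _).trans (by linarith [(hs x).2]),
      by gcongr; exact le_trans (by linarith [(hs x).1]) (le_max_right _ _)⟩)
    (hloc.one_sub.div_const hθ0) (hdiv (by
      obtain ⟨t, c, h⟩ := hdec
      refine ⟨1 - t, c, fun x => ?_⟩
      rw [sub_sub_sub_cancel_left, abs_sub_comm]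
      exact h x)) (mul_nonneg hN hθ0.le) (inv_pos.2 hθ0) C D
  refine ⟨(max E₁ E₂) ^ p₀, C, fun U hU hUB hUl => ?_⟩
  -- With T = V^(1/θ), the powers `s` and 1 - s of T are the powers s/θ and (1-s)/θ of V, both at
  -- most m/θ.
  set h : Rn n → ℝ≥0∞ := fun x => U x ^ θ with hh
  have hhm : Measurable h := hU.pow_const θ
  set V : Rn n → ℝ≥0∞ := fun x => h x + maximal h x with hVdef
  have hVm : Measurable V := hhm.add (measurable_maximal h)
  have hhU : ∀ x, h x ^ θ⁻¹ = U x := fun x => by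
    rw [hh, ← ENNReal.rpow_mul, mul_inv_cancel₀ hθ0.ne', ENNReal.rpow_one]
  have hVint : ∫⁻ x, V x ^ θ⁻¹ ≤ C := by
    calc ∫⁻ x, V x ^ θ⁻¹ ≤ ∫⁻ x, 2 ^ (θ⁻¹ - 1) * (h x ^ θ⁻¹ + maximal h x ^ θ⁻¹) :=
          lintegral_mono fun x => ENNReal.rpow_add_le_mul_rpow_add_rpow _ _ hq.le
      _ = 2 ^ (θ⁻¹ - 1) * ((∫⁻ x, h x ^ θ⁻¹) + ∫⁻ x, maximal h x ^ θ⁻¹) := by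
          rw [lintegral_const_mul' _ _ (ENNReal.rpow_ne_top_of_nonneg (by linarith) (by simp)),
            lintegral_add_left (hhm.pow_const _)]
      _ ≤ 2 ^ (θ⁻¹ - 1) * ((∫⁻ x, h x ^ θ⁻¹) + C₁ * ∫⁻ x, h x ^ θ⁻¹) := by
          gcongr; exact hC₁ h hhm
      _ ≤ 2 ^ (θ⁻¹ - 1) * (B + C₁ * B) := by simp_rw [hhU]; gcongr
      _ = C := by
          rw [hC]; push_cast
          rw [ENNReal.coe_rpow_of_nonneg _ (by linarith)]; push_cast; ring
  have hVl : ∀ x, ENNReal.ofReal ((1 + ‖x‖) ^ (-(N * θ))) ≤ V x := fun x => by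
    refine le_trans ?_ (le_self_add (a := h x))
    rw [← neg_mul, Real.rpow_mul (by positivity), ← ENNReal.ofReal_rpow_of_nonneg
      (by positivity) hθ0.le]
    exact ENNReal.rpow_le_rpow (hUl x) hθ0.le
  have hUT : ∀ x, U x ≤ V x ^ θ⁻¹ := fun x => by
    rw [← hhU x]; gcongr; exact le_self_add
  have hpow : ∀ x (e : ℝ), (V x ^ θ⁻¹) ^ e = V x ^ (e / θ) := fun x e => by
    rw [← ENNReal.rpow_mul, inv_mul_eq_div]
  refine ⟨fun x => V x ^ θ⁻¹, hVm.pow_const _, hUT, hVint, ?_⟩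
  refine isApWeight_of_variable_rpow hp₀ (T := fun x => V x ^ θ⁻¹) (hVm.pow_const _) (fun x => ?_)
    ?_ hsm ?_ ?_
  · refine (lt_of_lt_of_le ?_ ((hUl x).trans (hUT x))).ne'
    rw [ENNReal.ofReal_pos]; positivity
  · filter_upwards [ae_lt_top (hVm.pow_const θ⁻¹) (ne_top_of_le_ne_top ENNReal.coe_ne_top hVint)]
      with x hx using hx.ne
  · intro a l hl x hx
    simp_rw [hpow]
    refine (hE₁ V hVm (hD h hhm) hVint hVl a l hl x hx).trans ?_
    gcongr
    exact le_max_left _ _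
  · intro a l hl x hx
    simp_rw [hpow]
    refine (hE₂ V hVm (hD h hhm) hVint hVl a l hl x hx).trans ?_
    gcongr
    exact le_max_right _ _

/-! ### Log-Hölder exponents: continuity and bounds. -/

theorem LocallyLogHolder.continuous {p : Rn n → ℝ} (h : LocallyLogHolder p) : Continuous p := by
  obtain ⟨c, hc, h⟩ := h
  refine continuous_iff_continuousAt.2 fun x => ?_
  -- The punctured neighbourhood filter is trivial in dimension 0.
  by_cases hx : (nhdsWithin x {x}ᶜ).NeBot
  swap
  · rw [← continuousWithinAt_compl_self, ContinuousWithinAt, Filter.not_neBot.1 hx]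
    exact Filter.tendsto_bot
  rw [← continuousWithinAt_compl_self, ContinuousWithinAt, tendsto_iff_norm_sub_tendsto_zero]
  refine squeeze_zero (fun y => norm_nonneg _) (fun y => h y x) ?_
  have h1 : Filter.Tendsto (fun y => ‖y - x‖⁻¹) (nhdsWithin x {x}ᶜ) Filter.atTop :=
    (tendsto_norm_sub_self_nhdsNE x).inv_tendsto_nhdsGT_zero
  have h2 := Real.tendsto_log_atTop.comp
    (Filter.tendsto_atTop_add_const_left _ (Real.exp 1) h1)
  have h3 := h2.inv_tendsto_atTop.const_mul c
  simpa [Function.comp_def, one_div] using h3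

theorem LogHolderDecay.exists_bound {p : Rn n → ℝ} (h : LogHolderDecay p) :
    ∃ b, ∀ x, |p x| ≤ b := by
  obtain ⟨t, c, ht, hc, h⟩ := h
  refine ⟨t + c, fun x => ?_⟩
  have h1 : c * (1 / Real.log (Real.exp 1 + ‖x‖)) ≤ c := by
    have := one_le_log_exp_one_add (norm_nonneg x)
    rw [mul_one_div]
    exact div_le_self hc.le this
  calc |p x| = |(p x - t) + t| := by ring_nf
    _ ≤ |p x - t| + |t| := abs_add_le _ _
    _ ≤ t + c := by rw [abs_of_pos ht]; linarith [h x]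

/-- The essential bounds hold at every point, because `p` is continuous and a set of full measure is
dense. -/
theorem IsLogExponent.mem_Icc {p : Rn n → ℝ} (hp : IsLogExponent p) (x : Rn n) :
    p x ∈ Icc (essInf p volume) (essSup p volume) := by
  obtain ⟨b, hb⟩ := hp.decay.exists_bound
  have hcont := hp.locally_logHolder.continuous
  have h1 : ∀ᵐ x, p x ∈ Icc (essInf p volume) (essSup p volume) := by
    filter_upwards [ae_essInf_le (f := p) (μ := volume)
      (Filter.isBoundedUnder_of ⟨-b, fun x => (abs_le.1 (hb x)).1⟩),
      ae_le_essSup (f := p) (μ := volume)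
      (Filter.isBoundedUnder_of ⟨b, fun x => (abs_le.1 (hb x)).2⟩)] with x h1 h2 using ⟨h1, h2⟩
  exact (isClosed_Icc.preimage hcont).closure_subset (Measure.dense_of_ae h1 x)

theorem lintegral_rpow_neg_one_add_norm_lt_top :
    ∫⁻ x : Rn n, ENNReal.ofReal ((1 + ‖x‖) ^ (-((n : ℝ) + 1))) < ∞ :=
  finite_integral_one_add_norm (by simp)

/-! ### The pointwise estimate, modulars and Luxemburg norms. -/

/-- The pointwise estimate behind the extrapolation argument. -/
theorem rpow_le_mul_add_rpow_mul {φ T lam : ℝ≥0∞} {p p₀ : ℝ} (hp : 1 < p) (hp₀ : 1 < p₀)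
    (hT0 : T ≠ 0) (hTt : T ≠ ∞) (hl0 : lam ≠ 0) (hlt : lam ≠ ∞) (hφ : φ ^ p ≤ T) :
    φ ^ p ≤ lam * T + lam ^ (1 - p₀) * (φ ^ p₀ * T ^ (1 - p₀ / p)) := by
  have hp0 : 0 < p := by linarith
  have hφT : φ ≤ T ^ p⁻¹ := by
    rwa [ENNReal.le_rpow_inv_iff hp0]
  have hTp : T ^ p⁻¹ ≠ ∞ := ENNReal.rpow_ne_top_of_nonneg (by positivity) hTt
  have hφt : φ ≠ ∞ := ne_top_of_le_ne_top hTp hφT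
  have h1 : φ ^ p ≤ φ * T ^ (1 - p⁻¹) := by
    calc φ ^ p = φ ^ (1 : ℝ) * φ ^ (p - 1) := by
          rw [← ENNReal.rpow_add_of_nonneg _ _ zero_le_one (by linarith), add_sub_cancel]
      _ ≤ φ ^ (1 : ℝ) * (T ^ p⁻¹) ^ (p - 1) := by
          gcongr
      _ = _ := by
          rw [ENNReal.rpow_one, ← ENNReal.rpow_mul]
          congr 2
          field_simp
  refine h1.trans ?_
  -- Small φ is absorbed into λT; for large φ the negative power φ^(1-p₀) is at most
  -- (λT^(1/p))^(1-p₀).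
  rcases le_total φ (lam * T ^ p⁻¹) with h | h
  · refine le_trans ?_ le_self_add
    calc φ * T ^ (1 - p⁻¹) ≤ lam * T ^ p⁻¹ * T ^ (1 - p⁻¹) := by gcongr
      _ = lam * T := by
          rw [mul_assoc, ← ENNReal.rpow_add _ _ hT0 hTt, add_sub_cancel, ENNReal.rpow_one]
  · refine le_trans ?_ le_add_self
    have hpos : lam * T ^ p⁻¹ ≠ 0 :=
      mul_ne_zero hl0 (ENNReal.rpow_pos (pos_iff_ne_zero.2 hT0) hTt).ne'
    have hφ0 : φ ≠ 0 := ((pos_iff_ne_zero.2 hpos).trans_le h).ne'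
    calc φ * T ^ (1 - p⁻¹) = φ ^ p₀ * φ ^ (1 - p₀) * T ^ (1 - p⁻¹) := by
          rw [← ENNReal.rpow_add _ _ hφ0 hφt, add_sub_cancel, ENNReal.rpow_one]
      _ ≤ φ ^ p₀ * (lam * T ^ p⁻¹) ^ (1 - p₀) * T ^ (1 - p⁻¹) := by
          refine mul_le_mul_left (mul_le_mul_right ?_ _) _
          rw [← neg_sub, ENNReal.rpow_neg, ENNReal.rpow_neg, ENNReal.inv_le_inv]
          exact ENNReal.rpow_le_rpow h (by linarith)
      _ = lam ^ (1 - p₀) * (φ ^ p₀ * (T ^ (p⁻¹ * (1 - p₀)) * T ^ (1 - p⁻¹))) := by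
          rw [ENNReal.mul_rpow_of_ne_top hlt hTp, ← ENNReal.rpow_mul]; ring
      _ = _ := by
          rw [← ENNReal.rpow_add _ _ hT0 hTt]
          congr 3
          field_simp
          ring

theorem weightedIntegral_const_mul {s δ : ℝ} (hs : 0 ≤ s) (w : Rn n → ℝ≥0) {c : ℝ≥0∞}
    (hc : c ≠ ∞) (f : Rn n → ℝ≥0∞) :
    weightedIntegral s δ w (fun x => c * f x) = c ^ s * weightedIntegral s δ w f := by
  unfold weightedIntegral
  rw [← lintegral_const_mul' _ _ (ENNReal.rpow_ne_top_of_nonneg hs hc)]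
  simp_rw [ENNReal.mul_rpow_of_nonneg _ _ hs, mul_assoc]

theorem modular_mono {p : Rn n → ℝ} (hp : ∀ x, 0 ≤ p x) {f g : Rn n → ℝ≥0∞}
    (h : ∀ x, f x ≤ g x) : modular p f ≤ modular p g :=
  lintegral_mono fun x => ENNReal.rpow_le_rpow (h x) (hp x)

/-- Since p ≥ 1, dividing the function by k ≥ 1 divides the modular by at least k; the modular
itself, or 1 if larger, serves as k. -/
theorem MemVarLp.varNorm_ne_top {p : Rn n → ℝ} (hp : ∀ x, 1 ≤ p x) {f : Rn n → ℝ≥0∞}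
    (hf : MemVarLp p f) : varNorm p f ≠ ∞ := by
  obtain ⟨-, r, hr, hm⟩ := hf
  set k : ℝ≥0 := max 1 (modular p fun x => f x / r).toNNReal
  have hk1 : 1 ≤ k := le_max_left _ _
  have hk0 : 0 < k := zero_lt_one.trans_le hk1
  refine ne_top_of_le_ne_top (ENNReal.coe_ne_top (r := r * k))
    (sInf_le ⟨r * k, by positivity, ?_, rfl⟩)
  calc modular p (fun x => f x / (r * k : ℝ≥0)) ≤ ∫⁻ x, (k : ℝ≥0∞)⁻¹ * (f x / r) ^ p x := by
        refine lintegral_mono fun x => ?_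
        have h1 : f x / (r * k : ℝ≥0) = (k : ℝ≥0∞)⁻¹ * (f x / r) := by
          push_cast
          rw [div_eq_mul_inv, ENNReal.mul_inv (.inr ENNReal.coe_ne_top) (.inl ENNReal.coe_ne_top),
            div_eq_mul_inv]
          ring
        simp only [h1]
        rw [ENNReal.mul_rpow_of_nonneg _ _ (by linarith [hp x])]
        gcongr
        refine (ENNReal.rpow_le_rpow_of_exponent_ge ?_ (hp x)).trans_eq (ENNReal.rpow_one _)
        exact ENNReal.inv_le_one.2 (by exact_mod_cast hk1)
    _ = (k : ℝ≥0∞)⁻¹ * modular p (fun x => f x / r) := by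
        rw [lintegral_const_mul' _ _ (ENNReal.inv_ne_top.2 (by exact_mod_cast hk0.ne'))]; rfl
    _ ≤ (k : ℝ≥0∞)⁻¹ * k := by
        gcongr
        rw [← ENNReal.coe_toNNReal hm.ne]
        exact_mod_cast le_max_right _ _
    _ = 1 := ENNReal.inv_mul_cancel (by exact_mod_cast hk0.ne') ENNReal.coe_ne_top

/-- A comparison of norms follows from a comparison at scales just below the norm. -/
theorem varNorm_le_mul_of_forall {p : Rn n → ℝ} (hp : ∀ x, 1 ≤ p x) {f g : Rn n → ℝ≥0∞}
    (hf : MemVarLp p f) {C : ℝ≥0} (hC : C ≠ 0)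
    (h : ∀ a r : ℝ≥0, 0 < a → 0 < r → 1 ≤ modular p (fun x => f x / a) →
      modular p (fun x => f x / (2 * a : ℝ≥0)) ≤ 1 → modular p (fun x => g x / r) ≤ 1 →
      a ≤ C * r) :
    varNorm p f ≤ (2 * C : ℝ≥0) * varNorm p g := by
  have hp0 : ∀ x, 0 ≤ p x := fun x => by linarith [hp x]
  obtain ⟨N, hN⟩ : ∃ N : ℝ≥0, (N : ℝ≥0∞) = varNorm p f :=
    ⟨_, ENNReal.coe_toNNReal (hf.varNorm_ne_top hp)⟩
  rcases eq_or_ne N 0 with rfl | hN0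
  · rw [← hN]; simp
  have hNpos : 0 < N := pos_iff_ne_zero.2 hN0
  -- The scale a = 2N/3 satisfies a < N < 2a, which places the modular above 1 at `a` and below 1 at
  -- 2a; the inequality N < 2a costs the factor 2.
  have hlt : 2 / 3 * N < N := mul_lt_of_lt_one_left hNpos (by
    rw [div_lt_one (by norm_num)]; norm_num)
  have hlt' : N < 2 * (2 / 3 * N) := by
    rw [← mul_assoc]
    refine lt_mul_of_one_lt_left hNpos ?_
    rw [← mul_div_assoc, one_lt_div (by norm_num)]; norm_num
  have hC2 : ((2 * C : ℝ≥0) : ℝ≥0∞) ≠ 0 := ENNReal.coe_ne_zero.2 (mul_ne_zero two_ne_zero hC)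
  rw [mul_comm, ← ENNReal.div_le_iff hC2 ENNReal.coe_ne_top]
  refine le_sInf ?_
  rintro _ ⟨r, hr, hgr, rfl⟩
  rw [ENNReal.div_le_iff hC2 ENNReal.coe_ne_top, ← hN]
  have h1 : 1 ≤ modular p (fun x => f x / (2 / 3 * N : ℝ≥0)) := by
    by_contra! hlt1
    have : varNorm p f ≤ (2 / 3 * N : ℝ≥0) := sInf_le ⟨_, by positivity, hlt1.le, rfl⟩
    rw [← hN, ENNReal.coe_le_coe] at this
    exact this.not_gt hlt
  have h2 : modular p (fun x => f x / (2 * (2 / 3 * N) : ℝ≥0)) ≤ 1 := by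
    have : varNorm p f < (2 * (2 / 3 * N) : ℝ≥0) := by rw [← hN]; exact_mod_cast hlt'
    obtain ⟨_, ⟨t, ht, htm, rfl⟩, htlt⟩ := sInf_lt_iff.1 this
    refine (modular_mono hp0 fun x => ?_).trans htm
    exact ENNReal.div_le_div_left htlt.le _
  have h3 := h _ r (by positivity) hr h1 h2 hgr
  have h4 : N ≤ r * (2 * C) := by
    calc N ≤ 2 * (2 / 3 * N) := hlt'.le
      _ ≤ 2 * (C * r) := by gcongr
      _ = _ := by ring
  exact_mod_cast h4

/-! ### The exponent of the weight, and bounds for the weighted integrals. -/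

/-- The exponent `s` for which the `δ`-th power of `T ^ s * (T ^ (1 - s)) ^ (1 - p₀)` is
`T ^ (1 - p₀ / p)`. -/
noncomputable def splitExponent (p₀ δ p : ℝ) : ℝ := (1 + δ * (p₀ - 1) - p₀ / p) / (δ * p₀)

theorem splitExponent_mul {p₀ δ : ℝ} (hp₀ : 1 < p₀) (hδ : 0 < δ) (p : ℝ) :
    (p₀ * splitExponent p₀ δ p - (p₀ - 1)) * δ = 1 - p₀ / p := by
  have : p₀ ≠ 0 := by linarith
  unfold splitExponent
  generalize p₀ / p = y
  field_simp
  ring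

theorem splitExponent_mono {p₀ δ p q : ℝ} (hp₀ : 1 < p₀) (hδ : 0 < δ) (hp : 0 < p)
    (hpq : p ≤ q) : splitExponent p₀ δ p ≤ splitExponent p₀ δ q := by
  have : 0 < p₀ := by linarith
  unfold splitExponent
  gcongr

/-- Together with `splitExponent_lt_one`, this is where the bounds assumed on p⁻ and p⁺ enter. -/
theorem splitExponent_pos {p₀ δ p : ℝ} (hp₀ : 1 < p₀) (hδ : 0 < δ)
    (h : p₀ / (1 + δ * (p₀ - 1)) < p) : 0 < splitExponent p₀ δ p := by
  have h0 : 0 < p₀ := by linarith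
  have h1 : 0 < 1 + δ * (p₀ - 1) := by nlinarith
  have hp : 0 < p := (div_pos h0 h1).trans h
  rw [div_lt_comm₀ h1 hp] at h
  exact div_pos (by linarith) (by positivity)

theorem splitExponent_lt_one {p₀ δ p : ℝ} (hp₀ : 1 < p₀) (hδ : 0 < δ) (hδ1 : δ < 1) (hp : 0 < p)
    (h : p < p₀ / (1 - δ)) : splitExponent p₀ δ p < 1 := by
  have h0 : 0 < p₀ := by linarith
  rw [lt_div_comm₀ hp (by linarith)] at h
  rw [splitExponent, div_lt_one (by positivity)]
  linarith

/-- The exponent is affine in 1/p, so it inherits both log-Hölder conditions. Only positivity of `q`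
is required, so that the limit at infinity is admissible. -/
theorem abs_splitExponent_sub_le {p₀ δ p q : ℝ} (hp₀ : 1 < p₀) (hδ : 0 < δ) (hp : 1 ≤ p)
    (hq : 0 < q) : |splitExponent p₀ δ p - splitExponent p₀ δ q| ≤ |p - q| / (δ * q) := by
  have h0 : 0 < p₀ := by linarith
  have hp' : 0 < p := by linarith
  have : splitExponent p₀ δ p - splitExponent p₀ δ q = (p - q) / (δ * q) / p := by
    unfold splitExponent
    field_simp
    ring
  rw [this, abs_div, abs_div, abs_of_pos (mul_pos hδ hq), abs_of_pos hp']
  exact div_le_self (by positivity) hp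

theorem weightedIntegral_le_lintegral {p₀ δ : ℝ} (hp₀ : 0 < p₀) {p : Rn n → ℝ}
    (hp : ∀ x, 0 < p x) {T : Rn n → ℝ≥0∞} (hT0 : ∀ x, T x ≠ 0) (hTt : ∀ᵐ x, T x ≠ ∞)
    {w : Rn n → ℝ≥0} (hw : ∀ᵐ x, (w x : ℝ≥0∞) ^ δ = T x ^ (1 - p₀ / p x))
    {φ : Rn n → ℝ≥0∞} (hφ : ∀ᵐ x, φ x ^ p x ≤ T x) :
    weightedIntegral p₀ δ w φ ≤ ∫⁻ x, T x := by
  refine lintegral_mono_ae ?_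
  filter_upwards [hTt, hw, hφ] with x hxt hxw hxφ
  have h1 : φ x ≤ T x ^ (p x)⁻¹ := by rwa [ENNReal.le_rpow_inv_iff (hp x)]
  calc φ x ^ p₀ * (w x : ℝ≥0∞) ^ δ ≤ (T x ^ (p x)⁻¹) ^ p₀ * T x ^ (1 - p₀ / p x) := by
        rw [hxw]; gcongr
    _ = T x := by
        rw [← ENNReal.rpow_mul, ← ENNReal.rpow_add _ _ (hT0 x) hxt, inv_mul_eq_div,
          add_sub_cancel, ENNReal.rpow_one]

/-- Halving costs at most 2^(-P) because the exponents are bounded. This bounds below the modular of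
f at scale 2a, while the scale keeps that modular at most 1. -/
theorem modular_div_two_mul_ge {p : Rn n → ℝ} {P : ℝ} (hp : ∀ x, 0 ≤ p x) (hP : ∀ x, p x ≤ P)
    (f : Rn n → ℝ≥0∞) {a : ℝ≥0} :
    (2 : ℝ≥0∞) ^ (-P) * modular p (fun x => f x / a) ≤
      modular p (fun x => f x / (2 * a : ℝ≥0)) := by
  unfold modular
  rw [← lintegral_const_mul' _ _ (ENNReal.rpow_ne_top_of_ne_zero (by simp) (by simp))]
  refine lintegral_mono fun x => ?_
  have h1 : f x / (2 * a : ℝ≥0) = 2⁻¹ * (f x / a) := by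
    push_cast
    rw [div_eq_mul_inv, ENNReal.mul_inv (.inl (by simp)) (.inl (by simp)), div_eq_mul_inv]
    ring
  simp only [h1]
  rw [ENNReal.mul_rpow_of_nonneg _ _ (hp x), ENNReal.inv_rpow, ← ENNReal.rpow_neg]
  gcongr
  · norm_num
  · exact hP x

end VarLebesgue

/-! ### The extrapolation argument. -/

open VarLebesgue in

theorem corollary3p1 (n : ℕ) (hn : 1 ≤ n) (p₀ δ : ℝ) (hp₀ : 1 < p₀) (hδ₀ : 0 < δ) (hδ₁ : δ < 1)
    (F : Set ((VarLebesgue.Rn n → ℝ≥0∞) × (VarLebesgue.Rn n → ℝ≥0∞)))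
    (hF : ∀ fg ∈ F, AEMeasurable fg.1 volume ∧ AEMeasurable fg.2 volume)
    (hyp : ∀ K : ℝ≥0, ∃ C₀ : ℝ≥0, ∀ w : VarLebesgue.Rn n → ℝ≥0,
      VarLebesgue.IsApWeight p₀ K w → ∀ fg ∈ F,
        VarLebesgue.weightedIntegral p₀ δ w fg.1 < ∞ →
          VarLebesgue.weightedIntegral p₀ δ w fg.1 ≤
            C₀ * VarLebesgue.weightedIntegral p₀ δ w fg.2)
    (p : VarLebesgue.Rn n → ℝ) (hp : VarLebesgue.IsLogExponent p)
    (hlo : p₀ / (1 + δ * (p₀ - 1)) < essInf p volume)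
    (hhi : essSup p volume < p₀ / (1 - δ)) :
    ∃ C : ℝ≥0, ∀ fg ∈ F, VarLebesgue.MemVarLp p fg.1 →
      VarLebesgue.varNorm p fg.1 ≤ C * VarLebesgue.varNorm p fg.2 := by
  have hp1 : ∀ x, 1 < p x := hp.one_lt
  have hp0 : ∀ x, 0 < p x := fun x => by linarith [hp1 x]
  have hmem := hp.mem_Icc
  have hpm : Measurable p := hp.locally_logHolder.continuous.measurable
  set Pm := essInf p volume
  set P := essSup p volume
  have hPm0 : 0 < Pm := by linarith [hp.one_lt_essInf]
  have hP0 : 0 < P := hPm0.trans_le ((hmem 0).1.trans (hmem 0).2)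
  set s : Rn n → ℝ := fun x => splitExponent p₀ δ (p x) with hs
  have hsm : Measurable s := by
    unfold s splitExponent
    fun_prop
  have hsloc : LocallyLogHolder s := by
    obtain ⟨c, hc, h⟩ := hp.locally_logHolder
    refine ⟨c / δ, by positivity, fun x y => ?_⟩
    have h0 : |p x - p y| / (δ * p y) ≤ |p x - p y| / δ := by
      gcongr
      exact le_mul_of_one_le_right hδ₀.le (hp1 y).le
    calc |s x - s y| ≤ |p x - p y| / δ :=
          (abs_splitExponent_sub_le hp₀ hδ₀ (hp1 x).le (hp0 y)).trans h0
      _ ≤ c * (1 / Real.log (Real.exp 1 + 1 / ‖x - y‖)) / δ := by gcongr; exact h x y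
      _ = _ := by ring
  have hsdec : ∃ t c : ℝ, ∀ x, |s x - t| ≤ c * (1 / Real.log (Real.exp 1 + ‖x‖)) := by
    obtain ⟨t, c, ht, hc, h⟩ := hp.decay
    refine ⟨splitExponent p₀ δ t, c / (δ * t), fun x => ?_⟩
    calc |s x - _| ≤ |p x - t| / (δ * t) := abs_splitExponent_sub_le hp₀ hδ₀ (hp1 x).le ht
      _ ≤ c * (1 / Real.log (Real.exp 1 + ‖x‖)) / (δ * t) := by gcongr; exact h x
      _ = _ := by ring
  obtain ⟨E, hE⟩ : ∃ E : ℝ≥0, (E : ℝ≥0∞) =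
      ∫⁻ x : Rn n, ENNReal.ofReal ((1 + ‖x‖) ^ (-((n : ℝ) + 1))) :=
    ⟨_, ENNReal.coe_toNNReal lintegral_rpow_neg_one_add_norm_lt_top.ne⟩
  -- The bound 1 + 1 + E matches the three summands of U: the modulars of φ and γ, and the
  -- integrable power of 1+|x|.
  obtain ⟨K, C₁, hKC⟩ := exists_majorant_isApWeight hn hp₀ hsm
    (splitExponent_pos hp₀ hδ₀ hlo) (splitExponent_lt_one hp₀ hδ₀ hδ₁ hP0 hhi)
    (fun x => ⟨splitExponent_mono hp₀ hδ₀ hPm0 (hmem x).1,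
      splitExponent_mono hp₀ hδ₀ (hp0 x) (hmem x).2⟩)
    hsloc hsdec (N := (n : ℝ) + 1) (by positivity) (1 + 1 + E)
  obtain ⟨C₀, hC₀⟩ := hyp K
  set η : ℝ≥0 := 2 ^ (-P)
  have hη : 0 < η := by positivity
  -- Chosen so that λ ∫ T is at most half the lower bound η for the modular of φ.
  set lam : ℝ≥0 := η / (2 * (C₁ + 1))
  have hlam : 0 < lam := by positivity
  have hlamC : lam * C₁ ≤ η / 2 := by
    calc lam * C₁ ≤ lam * (C₁ + 1) := by gcongr; exact le_self_add
      _ = η / 2 := by simp only [lam]; field_simp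
  set A : ℝ≥0 := 2 / η * (lam ^ (1 - p₀) * (C₀ * C₁)) + 1
  have hA : 0 < A := by positivity
  have hp₀' : 0 < p₀ := by linarith
  refine ⟨2 * A ^ p₀⁻¹, fun fg hfg hf => varNorm_le_mul_of_forall (fun x => (hp1 x).le) hf
    (NNReal.rpow_pos hA).ne' fun a r ha hr hfa hf2 hgr => ?_⟩
  obtain ⟨hfm, hgm⟩ := hF fg hfg
  set f := fg.1
  set g := fg.2
  set φ : Rn n → ℝ≥0∞ := fun x => f x / (2 * a : ℝ≥0)
  set γ : Rn n → ℝ≥0∞ := fun x => g x / r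
  have hφm : AEMeasurable φ := hfm.div_const _
  have hγm : AEMeasurable γ := hgm.div_const _
  -- The majorant is built from measurable representatives, so it dominates φ^p and γ^p almost
  -- everywhere. Including γ bounds the right-hand weighted integral, including φ makes the
  -- left-hand one finite.
  obtain ⟨T, hTm, hUT, hTint, hTw⟩ := hKC (fun x => hφm.mk φ x ^ p x + hγm.mk γ x ^ p x +
      ENNReal.ofReal ((1 + ‖x‖) ^ (-((n : ℝ) + 1))))
    (((hφm.measurable_mk.pow hpm).add (hγm.measurable_mk.pow hpm)).add (by fun_prop)) (by
      rw [lintegral_add_right _ (by fun_prop),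
        lintegral_add_left (hφm.measurable_mk.pow hpm), ← hE]
      push_cast
      gcongr
      · refine le_trans (lintegral_mono_ae ?_) hf2
        filter_upwards [hφm.ae_eq_mk] with x hx using by rw [← hx]
      · refine le_trans (lintegral_mono_ae ?_) hgr
        filter_upwards [hγm.ae_eq_mk] with x hx using by rw [← hx])
    (fun x => le_add_self)
  set w : Rn n → ℝ≥0 := fun x => (T x ^ (p₀ * s x - (p₀ - 1))).toNNReal
  have hT0 : ∀ x, T x ≠ 0 := fun x => by
    refine (lt_of_lt_of_le ?_ (le_add_self.trans (hUT x))).ne'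
    rw [ENNReal.ofReal_pos]
    positivity
  have hTt : ∀ᵐ x, T x ≠ ∞ := by
    filter_upwards [ae_lt_top hTm (ne_top_of_le_ne_top ENNReal.coe_ne_top hTint)] with x hx
      using hx.ne
  have hφT : ∀ᵐ x, φ x ^ p x ≤ T x := by
    filter_upwards [hφm.ae_eq_mk] with x hx
    rw [hx]
    exact (le_self_add.trans le_self_add).trans (hUT x)
  have hγT : ∀ᵐ x, γ x ^ p x ≤ T x := by
    filter_upwards [hγm.ae_eq_mk] with x hx
    rw [hx]
    exact (le_add_self.trans le_self_add).trans (hUT x)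
  have hw : ∀ᵐ x, (w x : ℝ≥0∞) ^ δ = T x ^ (1 - p₀ / p x) := by
    filter_upwards [hTt] with x hx
    rw [ENNReal.coe_toNNReal (ENNReal.rpow_ne_top_of_ne_zero (hT0 x) hx), ← ENNReal.rpow_mul,
      splitExponent_mul hp₀ hδ₀]
  have hφw : weightedIntegral p₀ δ w φ ≤ C₁ :=
    (weightedIntegral_le_lintegral hp₀' hp0 hT0 hTt hw hφT).trans hTint
  have hγw : weightedIntegral p₀ δ w γ ≤ C₁ :=
    (weightedIntegral_le_lintegral hp₀' hp0 hT0 hTt hw hγT).trans hTint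
  have hscale : ∀ (h : Rn n → ℝ≥0∞) (c : ℝ≥0), 0 < c → weightedIntegral p₀ δ w h =
      (c ^ p₀ : ℝ≥0) * weightedIntegral p₀ δ w (fun x => h x / c) := fun h c hc => by
    rw [ENNReal.coe_rpow_of_nonneg _ hp₀'.le, ← weightedIntegral_const_mul hp₀'.le _
      ENNReal.coe_ne_top]
    congr 1
    ext x
    exact (ENNReal.mul_div_cancel (by exact_mod_cast hc.ne') ENNReal.coe_ne_top).symm
  have hfin : weightedIntegral p₀ δ w f < ∞ := by
    rw [hscale f (2 * a) (by positivity)]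
    exact ENNReal.mul_lt_top ENNReal.coe_lt_top (hφw.trans_lt ENNReal.coe_lt_top)
  have hmain := hC₀ w hTw fg hfg hfin
  change weightedIntegral p₀ δ w f ≤ C₀ * weightedIntegral p₀ δ w g at hmain
  rw [hscale f (2 * a) (by positivity), hscale g r hr] at hmain
  obtain ⟨X, hX⟩ : ∃ X : ℝ≥0, (X : ℝ≥0∞) = weightedIntegral p₀ δ w φ :=
    ⟨_, ENNReal.coe_toNNReal (ne_top_of_le_ne_top ENNReal.coe_ne_top hφw)⟩
  have hX1 : (2 * a) ^ p₀ * X ≤ C₀ * (r ^ p₀ * C₁) := by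
    have : (((2 * a) ^ p₀ : ℝ≥0) : ℝ≥0∞) * X ≤ C₀ * ((r ^ p₀ : ℝ≥0) * C₁) := by
      rw [hX]
      exact hmain.trans (by gcongr)
    exact_mod_cast this
  -- Integration of the pointwise estimate; the term λ C₁ is absorbed in `hX3`, which bounds the
  -- weighted integral of φ below.
  have hX2 : η ≤ lam * C₁ + lam ^ (1 - p₀) * X := by
    have h1 : (η : ℝ≥0∞) ≤ modular p φ := by
      refine le_trans ?_ (modular_div_two_mul_ge (fun x => (hp0 x).le) (fun x => (hmem x).2) f)
      rw [show (η : ℝ≥0∞) = 2 ^ (-P) from ENNReal.coe_rpow_of_ne_zero two_ne_zero _]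
      exact le_mul_of_one_le_right' hfa
    have h2 : modular p φ ≤ lam * C₁ + (lam ^ (1 - p₀) : ℝ≥0) * X := by
      rw [ENNReal.coe_rpow_of_ne_zero hlam.ne', hX]
      calc modular p φ ≤ ∫⁻ x, (lam * T x +
            (lam : ℝ≥0∞) ^ (1 - p₀) * (φ x ^ p₀ * (w x : ℝ≥0∞) ^ δ)) := by
            refine lintegral_mono_ae ?_
            filter_upwards [hTt, hw, hφT] with x hxt hxw hxφ
            rw [hxw]
            exact rpow_le_mul_add_rpow_mul (hp1 x) hp₀ (hT0 x) hxt (by exact_mod_cast hlam.ne')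
              ENNReal.coe_ne_top hxφ
        _ = lam * (∫⁻ x, T x) + (lam : ℝ≥0∞) ^ (1 - p₀) * weightedIntegral p₀ δ w φ := by
            rw [lintegral_add_left (hTm.const_mul _), lintegral_const_mul' _ _ ENNReal.coe_ne_top,
              lintegral_const_mul' _ _ (ENNReal.rpow_ne_top_of_ne_zero
                (by exact_mod_cast hlam.ne') ENNReal.coe_ne_top)]
            rfl
        _ ≤ _ := by gcongr
    exact_mod_cast h1.trans h2
  have hX3 : η / 2 ≤ lam ^ (1 - p₀) * X := by
    have : η / 2 + η / 2 ≤ η / 2 + lam ^ (1 - p₀) * X := by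
      rw [add_halves]
      exact hX2.trans (by gcongr)
    exact le_of_add_le_add_left this
  have hpow : a ^ p₀ ≤ A * r ^ p₀ := by
    calc a ^ p₀ ≤ (2 * a) ^ p₀ := by
          gcongr
          exact le_mul_of_one_le_left' one_le_two
      _ = 2 / η * ((2 * a) ^ p₀ * (η / 2)) := by field_simp
      _ ≤ 2 / η * ((2 * a) ^ p₀ * (lam ^ (1 - p₀) * X)) := by gcongr
      _ = 2 / η * (lam ^ (1 - p₀) * ((2 * a) ^ p₀ * X)) := by ring
      _ ≤ 2 / η * (lam ^ (1 - p₀) * (C₀ * (r ^ p₀ * C₁))) := by gcongr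
      _ = 2 / η * (lam ^ (1 - p₀) * (C₀ * C₁)) * r ^ p₀ := by ring
      _ ≤ A * r ^ p₀ := by gcongr; exact le_self_add
  have := NNReal.rpow_le_rpow hpow (inv_nonneg.2 hp₀'.le)
  rwa [NNReal.mul_rpow, ← NNReal.rpow_mul, ← NNReal.rpow_mul, mul_inv_cancel₀ hp₀'.ne',
    NNReal.rpow_one, NNReal.rpow_one] at this
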